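/- Let $T$ be a complete (one-sorted) first-order theory in a language $L$ of arbitrary cardinality, let $\kappa>|L|+\aleph_0$ be a strong limit cardinal, and let $\mathfrak C\models T$ be a monster model, i.e. $\mathfrak C$ is $\kappa$-saturated and strongly $\kappa$-homogeneous (every partial elementary map between subsets of cardinality $<\kappa$ extends to an automorphism). "Small" means of cardinality $<\kappa$. Say that $T$ is *amenable* if every complete type $p(\bar x)$ over $\emptyset$, in a possibly infinite (even unbounded) tuple of variables $\bar x$, extends to an $\mathrm{Aut}(\mathfrak C)$-invariant global Keisler measure, i.e. there is an $\mathrm{Aut}(\mathfrak C)$-invariant finitely additive probability measure on the Boolean algebra of subsets of $\mathfrak C^{\bar x}$ definable with parameters from $\mathfrak C$ that gives measure $1$ to every formula in $p$. Let $\mathrm{Autf}_L(\mathfrak C)$ be the subgroup of $\mathrm{Aut}(\mathfrak C)$ generated by all automorphisms fixing pointwise some small $M\prec\mathfrak C$, and let $\mathrm{Gal}_L(T)=\mathrm{Aut}(\mathfrak C)/\mathrm{Autf}_L(\mathfrak C)$. For a small $M\prec\mathfrak C$ enumerated as $\bar m$, equip $\mathrm{Gal}_L(T)$ with the quotient topology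 under the surjection $S_{\bar m}(M)\to \mathrm{Gal}_L(T)$, $\mathrm{tp}(\sigma(\bar m)/M)\mapsto \sigma\,\mathrm{Autf}_L(\mathfrak C)$, where $S_{\bar m}(M)$ is the space of complete types over $M$ extending $\mathrm{tp}(\bar m/\emptyset)$ (this topology does not depend on $M$). Let $\mathrm{Autf}_{KP}(\mathfrak C)$ be the preimage in $\mathrm{Aut}(\mathfrak C)$ of the closure of the identity of $\mathrm{Gal}_L(T)$. On the set $\mathfrak C^{I}$ of small tuples ($|I|<\kappa$) let $E_L$ and $E_{KP}$ be the orbit equivalence relations of $\mathrm{Autf}_L(\mathfrak C)$ and $\mathrm{Autf}_{KP}(\mathfrak C)$; their classes are the *Lascar strong types* and the *Kim–Pillay strong types*. The theory $T$ is *G-compact* if $\mathrm{Autf}_L(\mathfrak C)=\mathrm{Autf}_{KP}(\mathfrak C)$. The *Lascar distance* $d_L(\bar\alpha,\bar\beta)$ is the least $n$ for which there are tuples $\bar\alpha=\bar\alpha_0,\dots,\bar\alpha_n=\bar\beta$ and small models $M_0,\dots,M_{n-1}\prec\mathfrak C$ with $\mathrm{tp}(\bar\alpha_i/M_i)=\mathrm{tp}(\bar\alpha_{i+1}/M_i)$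 for all $i<n$, and the *Lascar diameter* of $[\bar\alpha]_{E_L}$ is $\sup\{d_L(\bar\alpha,\bar\beta):\bar\beta\in[\bar\alpha]_{E_L}\}$. **Theorem.** If $T$ is amenable, then $T$ is G-compact: $\mathrm{Autf}_L(\mathfrak C)=\mathrm{Autf}_{KP}(\mathfrak C)$, and $E_L=E_{KP}$ on $\mathfrak C^{I}$ for every small $I$. Moreover, for every small $I$ and every $\bar\alpha\in\mathfrak C^I$, the Lascar diameter of $[\bar\alpha]_{E_L}$ is at most $4$. -/

import Mathlib

open Cardinal FirstOrder

universe u v w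

namespace GCompact

variable {L : FirstOrder.Language.{u, v}} {C : Type w} [L.Structure C]

/-! ### Types over parameter sets and monster models -/

/-- `S_ι(A)`: the space of complete types over `A ⊆ C` in the variables `ι`
(with Mathlib's Stone topology). -/
abbrev TypesOver (L : FirstOrder.Language.{u, v}) {C : Type w} [L.Structure C] (A : Set C) (ι : Type w) :=
  (L[[A]].completeTheory C).CompleteType ι

/-- `tp(a/A)`: the complete type of the tuple `a` over `A`. -/
def tpOver (L : FirstOrder.Language.{u, v}) {C : Type w} [L.Structure C] [Nonempty C] {ι : Type w}
    (A : Set C) (a : ι → C) : TypesOver L A ι :=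
  (L[[A]].completeTheory C).typeOf a

/-- `C` is a monster model with respect to the cardinal `κ`: `κ` is a strong limit cardinal
greater than `|L| + ℵ₀`, and `C` is `κ`-saturated and strongly `κ`-homogeneous. -/
structure IsMonsterModel (L : FirstOrder.Language.{u, v}) (κ : Cardinal.{w}) (C : Type w) [L.Structure C]
    [Nonempty C] : Prop where
  isStrongLimit : κ.IsStrongLimit
  aleph0_lt : ℵ₀ < κ
  card_lt : Cardinal.lift.{w} L.card < Cardinal.lift.{max u v} κ
  /-- every complete `1`-type over a set of fewer than `κ` parameters is realized -/
  saturated : ∀ A : Set C, #A < κ → ∀ p : TypesOver L A PUnit, ∃ a : PUnit → C, tpOver L A a = p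
  /-- every elementary map defined on a set of fewer than `κ` elements extends to an
  automorphism -/
  homogeneous : ∀ (A : Set C) (f : A → C), #A < κ →
    (∀ φ : L.Formula A, φ.Realize ((↑) : A → C) ↔ φ.Realize f) →
    ∃ σ : C ≃[L] C, ∀ a : A, σ a = f a

/-- The automorphism group of `C`. -/
instance autGroup : Group (C ≃[L] C) where
  mul σ τ := σ.comp τ
  mul_assoc _ _ _ := rfl
  one := FirstOrder.Language.Equiv.refl L C
  one_mul _ := FirstOrder.Language.Equiv.ext fun _ => rfl
  mul_one _ := FirstOrder.Language.Equiv.ext fun _ => rfl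
  inv σ := σ.symm
  inv_mul_cancel σ := FirstOrder.Language.Equiv.ext fun x => σ.symm_apply_apply x

/-! ### Amenability -/

/-- The set `ψ(C)` of realizations of a formula without parameters. -/
def definedBy {ι : Type w} (ψ : L.Formula ι) : L.DefinableSet (Set.univ : Set C) ι :=
  ⟨{a | ψ.Realize a}, (Set.empty_definable_iff.2 ⟨ψ, rfl⟩).mono (Set.empty_subset _)⟩

/-- A global Keisler measure in the variables `ι`: a finitely additive probability measure on
the Boolean algebra of subsets of `C^ι` that are definable with parameters from `C`. -/
structure KeislerMeasure (L : FirstOrder.Language.{u, v}) (C : Type w) [L.Structure C] (ι : Type w) where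
  /-- the measure -/
  toFun : L.DefinableSet (Set.univ : Set C) ι → ℝ
  nonneg : ∀ D, 0 ≤ toFun D
  top : toFun ⊤ = 1
  add : ∀ D E, Disjoint D E → toFun (D ⊔ E) = toFun D + toFun E

/-- Invariance under `Aut(C)`: `μ(σ(D)) = μ(D)`, where `σ(D) = {σ(a) : a ∈ D}`. -/
def KeislerMeasure.IsInvariant {ι : Type w} (μ : KeislerMeasure L C ι) : Prop :=
  ∀ (σ : C ≃[L] C) (D E : L.DefinableSet (Set.univ : Set C) ι),
    (E : Set (ι → C)) = (fun a : ι → C => σ ∘ a) '' (D : Set (ι → C)) → μ.toFun E = μ.toFun D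

/-- `μ` extends the complete type `p` over `∅`: every formula of `p` has measure `1`. -/
def KeislerMeasure.Extends {ι : Type w} {T : L.Theory} (μ : KeislerMeasure L C ι)
    (p : T.CompleteType ι) : Prop :=
  ∀ ψ : L.Formula ι, FirstOrder.Language.Formula.equivSentence ψ ∈ p → μ.toFun (definedBy ψ) = 1

/-- `T` is amenable (computed in its monster model `C`): every complete type over `∅`, in
possibly infinitely many (also more than `|C|`) variables, extends to an `Aut(C)`-invariant global
Keisler measure. -/
def IsAmenable (T : L.Theory) (C : Type w) [L.Structure C] : Prop :=
  ∀ (ι : Type w) (p : T.CompleteType ι),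
    ∃ μ : KeislerMeasure L C ι, μ.IsInvariant ∧ μ.Extends p

/-! ### Lascar strong types

Throughout, "small" means of cardinality less than `κ`. -/

/-- `Autf_L(C)`: the group generated by the automorphisms fixing a small elementary submodel
pointwise. -/
def AutfL (L : FirstOrder.Language.{u, v}) (κ : Cardinal.{w}) (C : Type w) [L.Structure C] :
    Subgroup (C ≃[L] C) :=
  Subgroup.closure {σ | ∃ M : L.ElementarySubstructure C, #M < κ ∧ ∀ a ∈ M, σ a = a}

/-- `E_L`: the orbit equivalence relation of `Autf_L(C)` on `C^ι`. -/
def EL (L : FirstOrder.Language.{u, v}) (κ : Cardinal.{w}) {C : Type w} [L.Structure C] {ι : Type w}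
    (a b : ι → C) : Prop :=
  ∃ σ ∈ AutfL L κ C, σ ∘ a = b

/-- There are `a = c 0, …, c n = b` such that consecutive tuples have the same type over some
small elementary submodel. -/
def LascarChain (L : FirstOrder.Language.{u, v}) (κ : Cardinal.{w}) {C : Type w} [L.Structure C]
    [Nonempty C] {ι : Type w} (n : ℕ) (a b : ι → C) : Prop :=
  ∃ c : ℕ → ι → C, c 0 = a ∧ c n = b ∧ ∀ i < n, ∃ M : L.ElementarySubstructure C,
    #M < κ ∧ tpOver L (M : Set C) (c i) = tpOver L (M : Set C) (c (i + 1))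

/-- The Lascar distance `d_L(a, b)`: the least length of a chain from `a` to `b`
(`⊤` if there is none). -/
noncomputable def lascarDist (L : FirstOrder.Language.{u, v}) (κ : Cardinal.{w}) {C : Type w}
    [L.Structure C] [Nonempty C] {ι : Type w} (a b : ι → C) : ℕ∞ :=
  ⨅ (n : ℕ) (_ : LascarChain L κ n a b), (n : ℕ∞)

/-- The Lascar diameter of the Lascar strong type of `a`. -/
noncomputable def lascarDiam (L : FirstOrder.Language.{u, v}) (κ : Cardinal.{w}) {C : Type w}
    [L.Structure C] [Nonempty C] {ι : Type w} (a : ι → C) : ℕ∞ :=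
  ⨆ (b : ι → C) (_ : EL L κ a b), lascarDist L κ a b

/-! ### Galois groups and Kim-Pillay strong types -/

/-- `Gal_L(T) = Aut(C)/Autf_L(C)`. -/
abbrev GalL (L : FirstOrder.Language.{u, v}) (κ : Cardinal.{w}) (C : Type w) [L.Structure C] :=
  (C ≃[L] C) ⧸ AutfL L κ C

/-- The map `σ ↦ tp(σ(m)/M)`, where `m` is `M` enumerated by itself. -/
def typeMap [Nonempty C] (M : L.ElementarySubstructure C) (σ : C ≃[L] C) :
    TypesOver L (M : Set C) M :=
  tpOver L (M : Set C) fun x : M => σ x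

/-- The topology of `Gal_L(T)`, computed with a small model `M` enumerated as `m`. It is the
quotient topology under the surjection `S_m(M) → Gal_L(T)`, `tp(σ(m)/M) ↦ σ Autf_L(C)`.
In a monster model `S_m(M)` is the range of `typeMap M`, so a subset of `S_m(M)` is closed
if and only if its preimage in `Aut(C)` is closed for the topology induced by `typeMap M`; hence
the quotient topology is obtained by pulling the topology of types back to `Aut(C)` and pushing
it forward to `Gal_L(T)`. -/
@[reducible] def galLTopology [Nonempty C] (κ : Cardinal.{w}) (M : L.ElementarySubstructure C) :
    TopologicalSpace (GalL L κ C) :=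
  TopologicalSpace.coinduced (QuotientGroup.mk : (C ≃[L] C) → GalL L κ C)
    (TopologicalSpace.induced (typeMap M) inferInstance)

/-- `Gal_0(T)`: the closure of the identity of `Gal_L(T)`. -/
def Gal0 [Nonempty C] (κ : Cardinal.{w}) (M : L.ElementarySubstructure C) : Set (GalL L κ C) :=
  @closure _ (galLTopology κ M) {((1 : C ≃[L] C) : GalL L κ C)}

/-- `Autf_KP(C)`: the preimage of `Gal_0(T)` under `Aut(C) → Gal_L(T)`. -/
def AutfKP [Nonempty C] (κ : Cardinal.{w}) (M : L.ElementarySubstructure C) : Set (C ≃[L] C) :=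
  {σ | (σ : GalL L κ C) ∈ Gal0 κ M}

/-- `E_KP`: the orbit equivalence relation of `Autf_KP(C)` on `C^ι`. -/
def EKP [Nonempty C] (κ : Cardinal.{w}) (M : L.ElementarySubstructure C) {ι : Type w}
    (a b : ι → C) : Prop :=
  ∃ σ ∈ AutfKP κ M, σ ∘ a = b

/-- G-compactness: `Autf_L(C) = Autf_KP(C)` (the topology of `Gal_L(T)` being computed
with any small model `M`). -/
def IsGCompact (L : FirstOrder.Language.{u, v}) (κ : Cardinal.{w}) (C : Type w) [L.Structure C]
    [Nonempty C] : Prop :=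
  ∀ M : L.ElementarySubstructure C, #M < κ → (AutfL L κ C : Set (C ≃[L] C)) = AutfKP κ M

end GCompact

/-! The heart is a uniform bound: if σ lies in Autf_L and m is a small tuple, then m and σm are at
Lascar distance at most 4. By compactness it suffices to join them by paths of length four along
each ∅-definable approximation R = `nearSet M θ S` of "same type over a conjugate of M"
(`exists_chain_of_fourPath`).

Fix R. Finitely many fibers of R cover the orbit of m, so the fiber R(m) has positive measure for an
invariant μ extending tp(m). Among D ⊆ R(m) of positive measure choose one whose set E(D) of
R-neighbours has nearly minimal measure. If gD ∩ D is not too small, near-minimality forces gE(D) to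
be almost E(D). If h fixes a small model, a Morley sequence of a coheir yields one g such that gD
meets both D and hD substantially (`exists_recurrent`), so hE(D) is almost E(D). An element σ of
Autf_L is a product of n such h or their inverses, and n is known before the tolerance is chosen;
hence σE(D) still meets E(D) (`exists_pos_smul_inf`). A common point y gives the path m, x, y, σx',
σm with x, x' in D: four edges, whatever n is.

Because the path length is bounded, membership of σ in Autf_L is an intersection of closed
conditions on tp(σ(M)/M) (`mem_autfL_iff`). So the identity of Gal_L(T) is a closed point, which is
G-compactness. -/

namespace GCompact

/-! ### Finitely additive probability measures on Boolean algebras -/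

/-- A finitely additive probability measure on a Boolean algebra. -/
structure IsFinAddProb {B : Type*} [BooleanAlgebra B] (μ : B → ℝ) : Prop where
  nonneg : ∀ a, 0 ≤ μ a
  top : μ ⊤ = 1
  add : ∀ a b, Disjoint a b → μ (a ⊔ b) = μ a + μ b

namespace IsFinAddProb

variable {B : Type*} [BooleanAlgebra B] {μ : B → ℝ}

theorem inf_add_sdiff (h : IsFinAddProb μ) (a b : B) : μ (a ⊓ b) + μ (a \ b) = μ a := by
  rw [← h.add _ _ disjoint_inf_sdiff, sup_inf_sdiff]

theorem sup_add_inf (h : IsFinAddProb μ) (a b : B) : μ (a ⊔ b) + μ (a ⊓ b) = μ a + μ b := by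
  have h1 := h.add a (b \ a) disjoint_sdiff_self_right
  rw [sup_sdiff_self_right] at h1
  have h2 := h.inf_add_sdiff b a
  rw [inf_comm] at h2
  linarith

theorem mono (h : IsFinAddProb μ) {a b : B} (hab : a ≤ b) : μ a ≤ μ b := by
  have h1 := h.inf_add_sdiff b a
  rw [inf_eq_right.2 hab] at h1
  linarith [h.nonneg (b \ a)]

theorem le_one (h : IsFinAddProb μ) (a : B) : μ a ≤ 1 := h.top ▸ h.mono le_top

theorem bot (h : IsFinAddProb μ) : μ ⊥ = 0 := by
  have := h.add ⊥ ⊥ disjoint_bot_left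
  rw [sup_idem] at this
  linarith

theorem compl (h : IsFinAddProb μ) (a : B) : μ aᶜ = 1 - μ a := by
  have := h.inf_add_sdiff ⊤ a
  rw [top_inf_eq, top_sdiff, h.top] at this
  linarith

theorem sup_le (h : IsFinAddProb μ) (a b : B) : μ (a ⊔ b) ≤ μ a + μ b := by
  linarith [h.sup_add_inf a b, h.nonneg (a ⊓ b)]

/-- Triangle inequality for the defect μ(b) - μ(a ⊓ b): on translates of one element it is a
pseudometric, and this makes errors add along products of automorphisms. -/
theorem inf_inf_ge (h : IsFinAddProb μ) (a b c : B) :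
    μ (a ⊓ b) + μ (b ⊓ c) ≤ μ (a ⊓ c) + μ b := by
  have h1 := h.sup_add_inf (a ⊓ b) (b ⊓ c)
  have h2 : μ (a ⊓ b ⊔ b ⊓ c) ≤ μ b := h.mono (_root_.sup_le inf_le_right inf_le_left)
  have h3 : μ (a ⊓ b ⊓ (b ⊓ c)) ≤ μ (a ⊓ c) :=
    h.mono (le_inf (inf_le_left.trans inf_le_left) (inf_le_right.trans inf_le_right))
  linarith

theorem finset_sup_le (h : IsFinAddProb μ) {α : Type*} (s : Finset α) (f : α → B) :
    μ (s.sup f) ≤ ∑ i ∈ s, μ (f i) := by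
  classical
  induction s using Finset.induction_on with
  | empty => simp [h.bot]
  | insert i s hi ih =>
    rw [Finset.sup_insert, Finset.sum_insert hi]
    linarith [h.sup_le (f i) (s.sup f)]

/-- Second Bonferroni inequality: the new element contributes at least t and overlaps each of the n
earlier ones in at most s. -/
theorem sup_range_ge (h : IsFinAddProb μ) (f : ℕ → B) {s : ℝ} (t : ℝ)
    (ht : ∀ i, t ≤ μ (f i)) (hs : ∀ i j, i < j → μ (f i ⊓ f j) ≤ s) (n : ℕ) :
    n * t - n * (n - 1) / 2 * s ≤ μ ((Finset.range n).sup f) := by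
  induction n with
  | zero => simp [h.bot]
  | succ n ih =>
    rw [Finset.range_add_one, Finset.sup_insert]
    have h1 := h.sup_add_inf (f n) ((Finset.range n).sup f)
    have h2 : μ (f n ⊓ (Finset.range n).sup f) ≤ n * s := by
      rw [Finset.sup_inf_distrib_left]
      refine (h.finset_sup_le _ _).trans ?_
      calc ∑ i ∈ Finset.range n, μ (f n ⊓ f i) ≤ ∑ i ∈ Finset.range n, s :=
            Finset.sum_le_sum fun i hi => by
              rw [inf_comm]; exact hs i n (Finset.mem_range.1 hi)
        _ = n * s := by simp
    have h3 := ht n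
    push_cast
    nlinarith

/-- Infinitely many elements of measure at least `t` do not have pairwise small intersections. -/
theorem exists_inf_ge (h : IsFinAddProb μ) (f : ℕ → B) {t : ℝ} (ht0 : 0 < t)
    (ht : ∀ i, t ≤ μ (f i)) : ∃ i j, i < j ∧ t ^ 2 / 4 ≤ μ (f i ⊓ f j) := by
  by_contra! hc
  -- With n = ⌈2/t⌉ the product nt lies in [2, 3), where nt - (nt)²/8 exceeds 1.
  have h1 := h.sup_range_ge f t ht (fun i j hij => (hc i j hij).le) ⌈2 / t⌉₊
  have h2 := h.le_one ((Finset.range ⌈2 / t⌉₊).sup f)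
  set n : ℝ := (⌈2 / t⌉₊ : ℝ)
  have h3 : 2 ≤ n * t := by
    rw [← div_le_iff₀ ht0]; exact Nat.le_ceil _
  have h4 : n * t < 3 := by
    have h5 : n < 2 / t + 1 := Nat.ceil_lt_add_one (by positivity)
    have h6 : t ≤ 1 := (ht 0).trans (h.le_one _)
    calc n * t < (2 / t + 1) * t := by gcongr
      _ = 2 + t := by field_simp
      _ ≤ 3 := by linarith
  have h7 : n * (n - 1) / 2 * (t ^ 2 / 4) ≤ (n * t) ^ 2 / 8 := by
    have : 0 ≤ n := Nat.cast_nonneg _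
    nlinarith [mul_nonneg this (sq_nonneg t)]
  nlinarith

end IsFinAddProb

/-- A subadditive symmetric function which is bounded on `S` is bounded by a multiple of that
bound at every element of the group generated by `S`. -/
theorem exists_nat_mul_bound_of_mem_closure {G : Type*} [Group G] {S : Set G} {σ : G}
    (hσ : σ ∈ Subgroup.closure S) :
    ∃ n : ℕ, ∀ (ρ : G → ℝ) (δ : ℝ), ρ 1 = 0 → (∀ g h, ρ (g * h) ≤ ρ g + ρ h) →
      (∀ g, ρ g⁻¹ = ρ g) → (∀ g ∈ S, ρ g ≤ δ) → ρ σ ≤ n * δ := by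
  induction hσ using Subgroup.closure_induction with
  | mem x hx => exact ⟨1, fun ρ δ _ _ _ h => by simpa using h x hx⟩
  | one => exact ⟨0, fun ρ δ h _ _ _ => by simp [h]⟩
  | mul x y _ _ hx hy =>
    obtain ⟨n, hn⟩ := hx
    obtain ⟨k, hk⟩ := hy
    refine ⟨n + k, fun ρ δ h1 h2 h3 h4 => ?_⟩
    push_cast
    linarith [hn ρ δ h1 h2 h3 h4, hk ρ δ h1 h2 h3 h4, h2 x y]
  | inv x _ hx =>
    obtain ⟨n, hn⟩ := hx
    exact ⟨n, fun ρ δ h1 h2 h3 h4 => h3 x ▸ hn ρ δ h1 h2 h3 h4⟩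

/-! ### The measure-theoretic stabilizer argument -/

section Stabilizer

variable {G B : Type*} [Group G] [BooleanAlgebra B] [MulAction G B] {μ : B → ℝ} {E : B → B}

/-- Among the elements below `a` there is one at which `μ ∘ E` is nearly minimal. -/
theorem exists_nearly_minimal (hμ : IsFinAddProb μ) {a : B} (ha : 0 < μ a) {ε : ℝ} (hε : 0 < ε) :
    ∃ d ≤ a, 0 < μ d ∧ ∀ d' ≤ a, μ d ^ 2 / 4 ≤ μ d' → μ (E d) - ε ≤ μ (E d') := by
  by_contra! hc
  -- Each failure of near-minimality lowers μ(E d) by more than ε and keeps μ(d) positive; past 1/ε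
  -- failures the value would be negative.
  have key : ∀ k : ℕ, ∃ d ≤ a, 0 < μ d ∧ μ (E d) ≤ 1 - k * ε := by
    intro k
    induction k with
    | zero => exact ⟨a, le_rfl, ha, by simpa using hμ.le_one _⟩
    | succ k ih =>
      obtain ⟨d, hda, hd, hk⟩ := ih
      obtain ⟨d', hda', hd', hlt⟩ := hc d hda hd
      refine ⟨d', hda', lt_of_lt_of_le (by positivity) hd', ?_⟩
      push_cast
      linarith
  obtain ⟨k, hk⟩ := exists_nat_gt (1 / ε)
  obtain ⟨d, -, -, hd⟩ := key k
  rw [div_lt_iff₀ hε] at hk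
  linarith [hμ.nonneg (E d)]

/-- A form of the stabilizer theorem: if `E` is monotone and equivariant, and the elements of `S`
satisfy a recurrence property, then every element `σ` of the group generated by `S` moves some
`E d` with `d ≤ a` to an element that still meets it. -/
theorem exists_pos_smul_inf (hμ : IsFinAddProb μ)
    (smul_inf : ∀ (g : G) (d d' : B), g • (d ⊓ d') = g • d ⊓ g • d')
    (hinv : ∀ (g : G) (d : B), μ (g • d) = μ d)
    (hE : Monotone E) (hEs : ∀ (g : G) (d : B), E (g • d) = g • E d)
    {a : B} (ha : 0 < μ a) {t : ℝ} (ht : 0 < t) (hEt : ∀ d, 0 < μ d → t ≤ μ (E d))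
    {S : Set G}
    (hS : ∀ h ∈ S, ∀ (d : B) (s : ℝ),
      (∀ g : ℕ → G, ∃ i j, i < j ∧ s ≤ μ (g i • d ⊓ g j • d)) →
      ∃ g : G, s ≤ μ (g • d ⊓ d) ∧ s ≤ μ (g • d ⊓ h • d))
    {σ : G} (hσ : σ ∈ Subgroup.closure S) :
    ∃ d ≤ a, 0 < μ (σ • E d ⊓ E d) := by
  obtain ⟨n, hn⟩ := exists_nat_mul_bound_of_mem_closure hσ
  -- The number n depends on σ alone, so ε may be chosen after it, with n · 2ε < t.
  set ε : ℝ := t / (2 * n + 1) with hεdef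
  have hε : 0 < ε := by positivity
  obtain ⟨d, hda, hd, hmin⟩ := exists_nearly_minimal (E := E) hμ ha hε
  refine ⟨d, hda, ?_⟩
  -- Near-minimality is applied to d' = g • d ⊓ d, whose image under E lies below both g • E d and E
  -- d.
  have hgE : ∀ g : G, μ d ^ 2 / 4 ≤ μ (g • d ⊓ d) → μ (E d) - ε ≤ μ (g • E d ⊓ E d) := by
    intro g hg
    refine (hmin _ (inf_le_right.trans hda) hg).trans (hμ.mono ?_)
    rw [← hEs]
    exact le_inf (hE inf_le_left) (hE inf_le_right)
  have htrans : ∀ (g : G) (d d' : B), μ (g • d ⊓ g • d') = μ (d ⊓ d') := fun g d d' => by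
    rw [← smul_inf, hinv]
  -- The element g • E d is within ε of both E d and h • E d, and serves as the middle term of the
  -- triangle inequality.
  have hsub : ∀ h ∈ S, μ (E d) - μ (h • E d ⊓ E d) ≤ 2 * ε := by
    intro h hh
    obtain ⟨g, hg1, hg2⟩ := hS h hh d (μ d ^ 2 / 4) fun g => by
      exact hμ.exists_inf_ge (fun i => g i • d) hd fun i => (hinv _ _).ge
    have h1 := hgE g hg1
    have h2 := hgE (h⁻¹ * g) (by rw [← htrans h, smul_smul, mul_inv_cancel_left]; exact hg2)
    rw [← htrans h, smul_smul, mul_inv_cancel_left] at h2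
    have h3 := hμ.inf_inf_ge (h • E d) (g • E d) (E d)
    rw [inf_comm (h • E d) (g • E d), hinv] at h3
    linarith
  have hmain := hn (fun g => μ (E d) - μ (g • E d ⊓ E d)) (2 * ε) (by simp)
    (fun g h => by
      have h3 := hμ.inf_inf_ge ((g * h) • E d) (g • E d) (E d)
      rw [mul_smul, htrans, hinv] at h3
      rw [mul_smul]
      linarith)
    (fun g => by
      rw [← htrans g, smul_smul, mul_inv_cancel, one_smul, inf_comm]) hsub
  have h4 := hEt d hd
  have h5 : n * (2 * ε) < t := by
    rw [hεdef, mul_div_assoc', mul_div_assoc', div_lt_iff₀ (by positivity)]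
    nlinarith
  linarith

end Stabilizer

end GCompact

namespace GCompact

variable {L : FirstOrder.Language.{u, v}} {C : Type w} [L.Structure C]

open Filter Topology

/-! ### Definable sets in infinitely many variables -/

theorem Definable.exists_finite_support {A : Set C} {α : Type*} {Z : Set (α → C)}
    (hZ : A.Definable L Z) :
    ∃ (F : Finset α) (Y : Set (F → C)), A.Definable L Y ∧ Z = {x | (fun i : F => x i) ∈ Y} := by
  classical
  obtain ⟨φ, rfl⟩ := hZ
  refine ⟨φ.freeVarFinset, {y | Language.Formula.Realize (φ.restrictFreeVar id) y}, ⟨_, rfl⟩, ?_⟩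
  ext x
  exact (Language.BoundedFormula.realize_restrictFreeVar (f := id) x fun _ => rfl).symm

theorem Definable.exists_dependsOn {A : Set C} {α : Type*} {Z : Set (α → C)}
    (hZ : A.Definable L Z) :
    ∃ F : Finset α, DependsOn (· ∈ Z) (F : Set α) := by
  obtain ⟨F, Y, -, rfl⟩ := Definable.exists_finite_support hZ
  refine ⟨F, fun x y h => ?_⟩
  have : (fun i : F => x i) = fun i : F => y i := funext fun i => h i i.2
  simp only [Set.mem_ofPred_eq, this]

/-- Definable sets are closed under projections along possibly infinitely many coordinates. -/
theorem Definable.exists_sumElim [Nonempty C] {A : Set C} {α β : Type*} {Z : Set (α ⊕ β → C)}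
    (hZ : A.Definable L Z) : A.Definable L {x : α → C | ∃ y : β → C, Sum.elim x y ∈ Z} := by
  classical
  obtain ⟨F, Y, hY, rfl⟩ := Definable.exists_finite_support hZ
  let f : F → α ⊕ F.toRight := fun i => match i with
    | ⟨Sum.inl a, _⟩ => Sum.inl a
    | ⟨Sum.inr b, h⟩ => Sum.inr ⟨b, Finset.mem_toRight.2 h⟩
  have key := (hY.preimage_comp f).exists_of_finite
  convert key using 1
  ext x
  constructor
  · rintro ⟨y, hy⟩
    refine ⟨fun b => y b, ?_⟩
    have : Sum.elim x (fun b : F.toRight => y b) ∘ f = fun i : F => Sum.elim x y i := by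
      funext i
      obtain ⟨a | b, h⟩ := i <;> rfl
    rw [Set.mem_preimage, this]
    exact hy
  · rintro ⟨y, hy⟩
    refine ⟨fun b => if h : b ∈ F.toRight then y ⟨b, h⟩ else Classical.arbitrary C, ?_⟩
    have : (fun i : F => Sum.elim x
        (fun b => if h : b ∈ F.toRight then y ⟨b, h⟩ else Classical.arbitrary C) i) =
        Sum.elim x y ∘ f := by
      funext i
      obtain ⟨a | b, h⟩ := i
      · rfl
      · simp [f, h]
    rw [Set.mem_ofPred_eq, this]
    exact hy

theorem Definable.sumElim_section {A : Set C} {α β : Type*} {Z : Set (α ⊕ β → C)}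
    (hZ : A.Definable L Z) (y : α → C) :
    (A ∪ Set.range y).Definable L {x : β → C | Sum.elim y x ∈ Z} := by
  rw [Set.definable_iff_exists_formula_sum] at hZ ⊢
  obtain ⟨φ, rfl⟩ := hZ
  let f : A ⊕ (α ⊕ β) → ↥(A ∪ Set.range y) ⊕ β :=
    Sum.elim (fun a => Sum.inl ⟨a, Or.inl a.2⟩)
      (Sum.elim (fun a => Sum.inl ⟨y a, Or.inr ⟨a, rfl⟩⟩) Sum.inr)
  refine ⟨φ.relabel f, ?_⟩
  ext x
  simp only [Set.mem_ofPred_eq, Language.Formula.realize_relabel]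
  apply iff_of_eq
  congr 1
  funext i
  obtain a | a | b := i <;> rfl

theorem Definable.update_section {A : Set C} {ι : Type*} [DecidableEq ι] {Z : Set (ι → C)}
    (hZ : A.Definable L Z) (y : ι → C) (i : ι) :
    (A ∪ Set.range y).Definable L
      {a : PUnit.{w + 1} → C | Function.update y i (a PUnit.unit) ∈ Z} := by
  have := Definable.sumElim_section (hZ.preimage_comp
    (fun j => if j = i then Sum.inr PUnit.unit else Sum.inl j : ι → ι ⊕ PUnit.{w + 1})) y
  convert this using 1
  ext a
  have : Function.update y i (a PUnit.unit) = Sum.elim y a ∘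
      (fun j => if j = i then Sum.inr PUnit.unit else Sum.inl j : ι → ι ⊕ PUnit.{w + 1}) := by
    funext j
    by_cases hj : j = i
    · subst hj; simp
    · simp [hj]
  simp only [Set.mem_ofPred_eq, this, Set.mem_preimage]

theorem Definable.exists_update [Nonempty C] {A : Set C} {ι : Type*} [DecidableEq ι]
    {Z : Set (ι → C)} (hZ : A.Definable L Z) (i : ι) :
    A.Definable L {x : ι → C | ∃ a, Function.update x i a ∈ Z} := by
  have := Definable.exists_sumElim (hZ.preimage_comp
    (fun j => if j = i then Sum.inr PUnit.unit else Sum.inl j : ι → ι ⊕ PUnit.{1}))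
  convert this using 1
  ext x
  have key : ∀ a : PUnit.{1} → C, Function.update x i (a PUnit.unit) = Sum.elim x a ∘
      (fun j => if j = i then Sum.inr PUnit.unit else Sum.inl j : ι → ι ⊕ PUnit.{1}) := by
    intro a
    funext j
    by_cases hj : j = i
    · subst hj; simp
    · simp [hj]
  constructor
  · rintro ⟨a, ha⟩
    exact ⟨fun _ => a, by rw [Set.mem_preimage, ← key]; exact ha⟩
  · rintro ⟨a, ha⟩
    exact ⟨a PUnit.unit, by rw [key]; exact ha⟩

/-- The hybrid tuple equal to x on s and to y elsewhere agrees with x on s and with y on t. -/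
theorem _root_.DependsOn.inter_of_mem {ι X : Type*} {Z : Set (ι → X)} {s t : Set ι}
    (hs : DependsOn (· ∈ Z) s) (ht : DependsOn (· ∈ Z) t) : DependsOn (· ∈ Z) (s ∩ t) := by
  classical
  intro x y hxy
  refine (hs (y := fun i => if i ∈ s then x i else y i) fun i hi => ?_).trans
    (ht fun i hi => ?_)
  · simp [hi]
  · by_cases his : i ∈ s
    · simp only [his, if_true]
      exact hxy i ⟨his, hi⟩
    · simp [his]

/-! ### Automorphisms and definable sets -/

theorem Definable.comp_mem_iff {A : Set C} {ι : Type*} {Z : Set (ι → C)}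
    (hZ : A.Definable L Z) {σ : C ≃[L] C} (hσ : ∀ a ∈ A, σ a = a) (x : ι → C) :
    σ ∘ x ∈ Z ↔ x ∈ Z := by
  obtain ⟨φ, rfl⟩ := Set.definable_iff_exists_formula_sum.1 hZ
  rw [Set.mem_ofPred_eq, Set.mem_ofPred_eq,
    ← Language.StrongHomClass.realize_formula σ φ (v := Sum.elim _ x)]
  apply iff_of_eq
  congr 1
  funext i
  obtain a | b := i
  · exact (hσ a a.2).symm
  · rfl

theorem comp_mem_iff_of_empty {ι : Type*} {Z : Set (ι → C)} (hZ : (∅ : Set C).Definable L Z)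
    (σ : C ≃[L] C) (x : ι → C) : σ ∘ x ∈ Z ↔ x ∈ Z :=
  Definable.comp_mem_iff hZ (fun _ h => h.elim) x

theorem Definable.image_equiv {A : Set C} {ι : Type*} {Z : Set (ι → C)}
    (hZ : A.Definable L Z) (σ : C ≃[L] C) :
    (σ '' A).Definable L ((fun x : ι → C => σ ∘ x) '' Z) := by
  rw [Set.definable_iff_exists_formula_sum] at hZ ⊢
  obtain ⟨φ, rfl⟩ := hZ
  refine ⟨φ.relabel (Sum.map (fun a : A => (⟨σ a, Set.mem_image_of_mem _ a.2⟩ : ↥(σ '' A))) id), ?_⟩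
  ext x
  simp only [Set.mem_ofPred_eq, Language.Formula.realize_relabel, Set.mem_image]
  have key : ∀ y : ι → C, φ.Realize (Sum.elim (fun a : A => (a : C)) y) ↔
      φ.Realize (Sum.elim (fun a : ↥(σ '' A) => (a : C)) (σ ∘ y) ∘
        Sum.map (fun a : A => ⟨σ a, Set.mem_image_of_mem _ a.2⟩) id) := by
    intro y
    rw [← Language.StrongHomClass.realize_formula σ φ]
    apply iff_of_eq
    congr 1
    funext i
    obtain a | b := i <;> rfl
  constructor
  · rintro ⟨y, hy, rfl⟩
    exact (key y).1 hy
  · intro hx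
    refine ⟨σ.symm ∘ x, (key _).2 ?_, ?_⟩
    · convert hx using 4
      funext i; simp
    · funext i; simp

/-- Allows all later arguments to use definable sets in place of formulas and types. -/
theorem tpOver_eq_iff [Nonempty C] {ι : Type w} {A : Set C} {a b : ι → C} :
    tpOver L A a = tpOver L A b ↔ ∀ Z : Set (ι → C), A.Definable L Z → (a ∈ Z ↔ b ∈ Z) := by
  constructor
  · rintro h Z ⟨φ, rfl⟩
    have := SetLike.ext_iff.1 h (Language.Formula.equivSentence φ)
    rw [tpOver, tpOver, Language.Theory.CompleteType.formula_mem_typeOf,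
      Language.Theory.CompleteType.formula_mem_typeOf] at this
    exact this
  · intro h
    refine SetLike.ext fun φ => ?_
    rw [tpOver, tpOver, Language.Theory.CompleteType.mem_typeOf,
      Language.Theory.CompleteType.mem_typeOf]
    exact h _ ⟨_, rfl⟩

theorem isClosed_setOf_typeMap_mem [Nonempty C] (M : L.ElementarySubstructure C) {Z : Set (M → C)}
    (hZ : (M : Set C).Definable L Z) :
    IsClosed[TopologicalSpace.induced (typeMap M) inferInstance]
      {σ : C ≃[L] C | (fun x : M => σ x) ∈ Z} := by
  obtain ⟨φ, rfl⟩ := hZ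
  refine isClosed_induced_iff.2
    ⟨_, CompleteType.isClosed_typesWith (Language.Formula.equivSentence φ), ?_⟩
  ext σ
  simp only [Set.mem_preimage, Language.Theory.CompleteType.mem_typesWith_iff, typeMap, tpOver,
    Language.Theory.CompleteType.formula_mem_typeOf]
  rfl

/-! ### Saturation and homogeneity for small tuples -/

/-- `y` satisfies the part of the definable `A`-type of the ultrafilter `U` which only involves
the coordinates in `J`. -/
def RealizesOn (L : FirstOrder.Language.{u, v}) {C : Type w} [L.Structure C] {ι : Type w}
    (A : Set C) (U : Ultrafilter (ι → C)) (J : Set ι) (y : ι → C) : Prop :=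
  ∀ Z, A.Definable L Z → DependsOn (· ∈ Z) J → Z ∈ U → y ∈ Z

theorem RealizesOn.congr {ι : Type w} {A : Set C} {U : Ultrafilter (ι → C)} {J : Set ι}
    {y z : ι → C} (h : RealizesOn L A U J y) (hyz : ∀ i ∈ J, y i = z i) :
    RealizesOn L A U J z := fun Z hZ hJ hU =>
  (iff_of_eq (hJ hyz)).1 (h Z hZ hJ hU)

/-- A definable set depends on finitely many coordinates, and the largest of them in J puts it under
the control of one initial segment. Hence limit stages of the recursion in `exists_realization` cost
nothing. -/
theorem realizesOn_of_forall_Iic {ι : Type w} [LinearOrder ι] {A : Set C} {U : Ultrafilter (ι → C)}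
    {J : Set ι} {y : ι → C}
    (h : ∀ i ∈ J, RealizesOn L A U (Set.Iic i) y) : RealizesOn L A U J y := by
  classical
  intro Z hZ hZJ hZU
  obtain ⟨F, hF⟩ := Definable.exists_dependsOn hZ
  have hFJ := hF.inter_of_mem hZJ
  rcases (F.filter (· ∈ J)).eq_empty_or_nonempty with hE | hE
  · obtain ⟨x, hx⟩ := U.nonempty_of_mem hZU
    refine (iff_of_eq (hFJ (x := x) (y := y) ?_)).1 hx
    rintro i ⟨hi, hiJ⟩
    exact absurd (Finset.mem_filter.2 ⟨hi, hiJ⟩) (hE ▸ Finset.notMem_empty i)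
  · have hmax := (F.filter (· ∈ J)).max'_mem hE
    refine h _ (Finset.mem_filter.1 hmax).2 Z hZ (hFJ.mono ?_) hZU
    rintro i ⟨hi, hiJ⟩
    exact Finset.le_max' _ _ (Finset.mem_filter.2 ⟨hi, hiJ⟩)

namespace IsMonsterModel

variable [Nonempty C] {κ : Cardinal.{w}}

theorem card_union_range_lt (hC : IsMonsterModel L κ C) {ι : Type w} (hι : #ι < κ) {A : Set C}
    (hA : #A < κ) (y : ι → C) : #↥(A ∪ Set.range y) < κ :=
  (mk_union_le _ _).trans_lt (add_lt_of_lt hC.aleph0_lt.le hA (mk_range_le.trans_lt hι))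

/-- The image of V converges in the compact space of 1-types, and saturation realizes the limit. -/
theorem exists_realization_one (hC : IsMonsterModel L κ C) {A : Set C} (hA : #A < κ)
    (V : Ultrafilter (PUnit.{w + 1} → C)) :
    ∃ a : PUnit → C, ∀ Z, A.Definable L Z → Z ∈ V → a ∈ Z := by
  obtain ⟨p, -, hp⟩ := isCompact_univ.ultrafilter_le_nhds (V.map (tpOver L A)) (by simp)
  obtain ⟨a, ha⟩ := hC.saturated A hA p
  refine ⟨a, ?_⟩
  rintro Z ⟨φ, rfl⟩ hZ
  have : p ∈ Language.Theory.typesWith (L[[A]].completeTheory C)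
      (Language.Formula.equivSentence φ) := by
    refine (CompleteType.isClosed_typesWith _).mem_of_frequently_of_tendsto
      (f := id) (b := (V.map (tpOver L A) : Filter _)) ?_ (Filter.tendsto_id'.2 hp)
    refine Filter.Eventually.frequently (Ultrafilter.mem_map.2 ?_)
    filter_upwards [hZ] with x hx
    simpa [tpOver] using hx
  rw [← ha] at this
  simpa [tpOver] using this

/-- Projecting a set of U along coordinate i gives a set of U that depends only on earlier
coordinates, hence contains y. So the conditions on the new entry are finitely satisfiable, over the
small set A ∪ range y. -/
theorem exists_update_realizesOn (hC : IsMonsterModel L κ C) {ι : Type w} [LinearOrder ι]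
    (hι : #ι < κ) {A : Set C} (hA : #A < κ) {U : Ultrafilter (ι → C)} {i : ι} {y : ι → C}
    (h : RealizesOn L A U (Set.Iio i) y) :
    ∃ a, RealizesOn L A U (Set.Iic i) (Function.update y i a) := by
  classical
  let P : Set (Set (ι → C)) := {Z | A.Definable L Z ∧ DependsOn (· ∈ Z) (Set.Iic i) ∧ Z ∈ U}
  let S : Set (ι → C) → Set (PUnit.{w + 1} → C) :=
    fun Z => {a | Function.update y i (a PUnit.unit) ∈ Z}
  have hne : ∀ Z ∈ P, (S Z).Nonempty := by
    rintro Z ⟨hZ, hZd, hZU⟩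
    have : y ∈ {x : ι → C | ∃ a, Function.update x i a ∈ Z} := by
      refine h _ (Definable.exists_update hZ i) ?_ ?_
      · intro x x' hx
        refine propext (exists_congr fun a => iff_of_eq (hZd fun j hj => ?_))
        rcases eq_or_ne j i with rfl | hji
        · simp
        · simp [hji, hx j (lt_of_le_of_ne hj hji)]
      · filter_upwards [hZU] with x hx
        exact ⟨x i, by simpa using hx⟩
    obtain ⟨a, ha⟩ := this
    exact ⟨fun _ => a, ha⟩
  have hP : P.Nonempty := ⟨Set.univ, Set.definable_univ, fun _ _ _ => rfl, Filter.univ_mem⟩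
  have : Nonempty P := hP.to_subtype
  have hdir : Directed (· ≥ ·) fun Z : P => Filter.principal (S Z) := by
    rintro ⟨Z, hZ, hZd, hZU⟩ ⟨Y, hY, hYd, hYU⟩
    refine ⟨⟨Z ∩ Y, hZ.inter hY, fun x x' hx => ?_, Filter.inter_mem hZU hYU⟩, ?_, ?_⟩
    · exact congr_arg₂ And (hZd hx) (hYd hx)
    · exact Filter.principal_mono.2 fun a ha => ha.1
    · exact Filter.principal_mono.2 fun a ha => ha.2
  have hNe : (⨅ Z : P, Filter.principal (S Z)).NeBot :=
    Filter.iInf_neBot_of_directed hdir fun Z => Filter.principal_neBot_iff.2 (hne Z Z.2)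
  obtain ⟨a, ha⟩ := hC.exists_realization_one (hC.card_union_range_lt hι hA y)
    (Ultrafilter.of (⨅ Z : P, Filter.principal (S Z)))
  refine ⟨a PUnit.unit, fun Z hZ hZd hZU => ?_⟩
  exact ha _ (Definable.update_section hZ y i) (Ultrafilter.of_le _
    (Filter.mem_iInf_of_mem ⟨Z, hZ, hZd, hZU⟩ (Filter.mem_principal_self _)))

/-- The type over a small set of an ultrafilter on the set of small tuples is realized. -/
theorem exists_realization (hC : IsMonsterModel L κ C) {ι : Type w} (hι : #ι < κ) {A : Set C}
    (hA : #A < κ) (U : Ultrafilter (ι → C)) :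
    ∃ y : ι → C, ∀ Z, A.Definable L Z → Z ∈ U → y ∈ Z := by
  classical
  obtain ⟨_, _⟩ := exists_wellFoundedLT ι
  let step : ∀ i : ι, (∀ j, j < i → C) → C := fun i f =>
    Classical.epsilon fun a => RealizesOn L A U (Set.Iic i)
      (Function.update (fun j => if h : j < i then f j h else Classical.arbitrary C) i a)
  let y : ι → C := (wellFounded_lt (α := ι)).fix step
  have hy : ∀ i, RealizesOn L A U (Set.Iic i) y := by
    intro i
    induction i using (wellFounded_lt (α := ι)).induction with
    | _ i ih =>
      have h1 : RealizesOn L A U (Set.Iio i) y := realizesOn_of_forall_Iic ih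
      have h2 : RealizesOn L A U (Set.Iio i)
          (fun j => if j < i then y j else Classical.arbitrary C) :=
        h1.congr fun j hj => by simp [Set.mem_Iio.1 hj]
      have h3 := Classical.epsilon_spec (hC.exists_update_realizesOn hι hA h2)
      refine RealizesOn.congr h3 fun j hj => ?_
      rcases eq_or_ne j i with rfl | hji
      · rw [Function.update_self]
        exact ((wellFounded_lt (α := ι)).fix_eq step j).symm
      · rw [Function.update_of_ne hji, if_pos (lt_of_le_of_ne hj hji)]
  refine ⟨y, fun Z hZ hZU => ?_⟩
  exact realizesOn_of_forall_Iic (J := Set.univ) (fun i _ => hy i) Z hZ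
    (fun x x' h => congr_arg (· ∈ Z) (funext fun i => h i trivial)) hZU

theorem exists_mem_of_directed (hC : IsMonsterModel L κ C) {ι : Type w} (hι : #ι < κ)
    {A : Set C} (hA : #A < κ) {P : Set (Set (ι → C))} (hP : P.Nonempty)
    (hdef : ∀ Z ∈ P, A.Definable L Z) (hne : ∀ Z ∈ P, Z.Nonempty)
    (hinter : ∀ Z ∈ P, ∀ Y ∈ P, ∃ X ∈ P, X ⊆ Z ∩ Y) :
    ∃ y : ι → C, ∀ Z ∈ P, y ∈ Z := by
  have : Nonempty P := hP.to_subtype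
  have hNe : (⨅ Z : P, Filter.principal (Z : Set (ι → C))).NeBot := by
    refine Filter.iInf_neBot_of_directed ?_ fun Z => Filter.principal_neBot_iff.2 (hne Z Z.2)
    rintro ⟨Z, hZ⟩ ⟨Y, hY⟩
    obtain ⟨X, hX, hXZY⟩ := hinter Z hZ Y hY
    exact ⟨⟨X, hX⟩, Filter.principal_mono.2 fun _ h => (hXZY h).1,
      Filter.principal_mono.2 fun _ h => (hXZY h).2⟩
  obtain ⟨y, hy⟩ := hC.exists_realization hι hA
    (Ultrafilter.of (⨅ Z : P, Filter.principal (Z : Set (ι → C))))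
  exact ⟨y, fun Z hZ => hy Z (hdef Z hZ) (Ultrafilter.of_le _
    (Filter.mem_iInf_of_mem ⟨Z, hZ⟩ (Filter.mem_principal_self _)))⟩

/-- Small tuples of the same type are conjugate. -/
theorem exists_equiv (hC : IsMonsterModel L κ C) {ι : Type w} (hι : #ι < κ) {a b : ι → C}
    (h : ∀ Z, (∅ : Set C).Definable L Z → a ∈ Z → b ∈ Z) :
    ∃ σ : C ≃[L] C, σ ∘ a = b := by
  have h' : ∀ φ : L.Formula ι, φ.Realize a ↔ φ.Realize b := fun φ =>
    ⟨h _ (Set.empty_definable_iff.2 ⟨φ, rfl⟩), fun hb => by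
      by_contra ha
      exact h _ (Set.empty_definable_iff.2 ⟨φ.not, rfl⟩) ha hb⟩
  choose s hs using fun x : Set.range a => x.2
  obtain ⟨σ, hσ⟩ := hC.homogeneous (Set.range a) (fun x => b (s x)) (mk_range_le.trans_lt hι)
    fun φ => by
      have := h' (φ.relabel s)
      rw [Language.Formula.realize_relabel, Language.Formula.realize_relabel] at this
      rw [show a ∘ s = Subtype.val from funext hs] at this
      exact this
  refine ⟨σ, funext fun i => (hσ ⟨a i, i, rfl⟩).trans ?_⟩
  -- The entries of a may repeat; the formula equating the chosen index with i transfers to b, so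
  -- the choice of index is harmless.
  have h1 := h {x | x (s ⟨a i, i, rfl⟩) = x i}
    (Set.empty_definable_iff.2 ⟨(Language.Term.var (s ⟨a i, i, rfl⟩)).equal
      (Language.Term.var i), by ext; simp⟩) (hs ⟨a i, i, rfl⟩)
  exact h1

end IsMonsterModel

/-! ### The action of the automorphism group on definable sets -/

instance {ι : Type w} : MulAction (C ≃[L] C) (L.DefinableSet (Set.univ : Set C) ι) where
  smul σ D := ⟨(fun x : ι → C => σ ∘ x) '' (D : Set (ι → C)),
    (Definable.image_equiv D.2 σ).mono (Set.subset_univ _)⟩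
  one_smul D := SetLike.coe_injective (Set.image_id (D : Set (ι → C)))
  mul_smul σ τ D := SetLike.coe_injective
    (Set.image_image (fun x : ι → C => σ ∘ x) (fun x => τ ∘ x) (D : Set (ι → C))).symm

theorem comp_comp_symm {α : Type*} (σ : C ≃[L] C) (y : α → C) : σ ∘ (σ.symm ∘ y) = y :=
  funext fun i => σ.apply_symm_apply (y i)

theorem comp_mem_smul_iff {ι : Type w} (σ : C ≃[L] C) (D : L.DefinableSet (Set.univ : Set C) ι)
    (x : ι → C) : σ ∘ x ∈ σ • D ↔ x ∈ D :=
  (σ.injective.comp_left).mem_set_image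

theorem mem_smul_iff {ι : Type w} (σ : C ≃[L] C) (D : L.DefinableSet (Set.univ : Set C) ι)
    (x : ι → C) : x ∈ σ • D ↔ σ.symm ∘ x ∈ D := by
  rw [← comp_mem_smul_iff σ D (σ.symm ∘ x), comp_comp_symm]

theorem smul_definableSet_inf {ι : Type w} (σ : C ≃[L] C)
    (D E : L.DefinableSet (Set.univ : Set C) ι) : σ • (D ⊓ E) = σ • D ⊓ σ • E := by
  refine SetLike.ext fun x => ?_
  simp only [mem_smul_iff, Language.DefinableSet.mem_inf]

theorem smul_eq_smul_of_comp_eq {ι : Type w} {A : Set C}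
    {D : L.DefinableSet (Set.univ : Set C) ι} (hD : A.Definable L (D : Set (ι → C)))
    {σ τ : C ≃[L] C} (h : ∀ a ∈ A, σ a = τ a) : σ • D = τ • D := by
  rw [← inv_smul_eq_iff, smul_smul]
  refine SetLike.ext fun x => ?_
  rw [mem_smul_iff]
  refine Definable.comp_mem_iff hD (σ := (τ⁻¹ * σ).symm) (fun a ha => ?_) x
  change σ.symm (τ a) = a
  rw [← h a ha, Language.Equiv.symm_apply_apply]

namespace KeislerMeasure

variable {ι : Type w} {μ : KeislerMeasure L C ι}

theorem isFinAddProb (μ : KeislerMeasure L C ι) : IsFinAddProb μ.toFun :=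
  ⟨μ.nonneg, μ.top, μ.add⟩

theorem IsInvariant.smul_eq (h : μ.IsInvariant) (σ : C ≃[L] C)
    (D : L.DefinableSet (Set.univ : Set C) ι) : μ.toFun (σ • D) = μ.toFun D :=
  h σ D (σ • D) rfl

end KeislerMeasure

/-! ### Neighbours of a definable set under a definable relation -/

section Neighbours

variable {ι : Type w} {R : Set (ι ⊕ ι → C)}

/-- The set of `y` which are `R`-related to `x`. -/
def relFiber (hR : (∅ : Set C).Definable L R) (x : ι → C) :
    L.DefinableSet (Set.univ : Set C) ι :=
  ⟨{y | Sum.elim x y ∈ R}, (Definable.sumElim_section hR x).mono (Set.subset_univ _)⟩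

theorem mem_relFiber {hR : (∅ : Set C).Definable L R} {x y : ι → C} :
    y ∈ relFiber hR x ↔ Sum.elim x y ∈ R :=
  Iff.rfl

theorem sumElim_comp_mem_iff (hR : (∅ : Set C).Definable L R) (σ : C ≃[L] C) (x y : ι → C) :
    Sum.elim (σ ∘ x) (σ ∘ y) ∈ R ↔ Sum.elim x y ∈ R := by
  rw [← Sum.comp_elim, comp_mem_iff_of_empty hR]

theorem smul_relFiber (hR : (∅ : Set C).Definable L R) (σ : C ≃[L] C) (x : ι → C) :
    σ • relFiber hR x = relFiber hR (σ ∘ x) := by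
  refine SetLike.ext fun y => ?_
  rw [mem_smul_iff, mem_relFiber, mem_relFiber, ← sumElim_comp_mem_iff hR σ, comp_comp_symm]

variable [Nonempty C]

/-- The set of `y` which are `R`-related to some element of `D`. -/
def neighbours (hR : (∅ : Set C).Definable L R) (D : L.DefinableSet (Set.univ : Set C) ι) :
    L.DefinableSet (Set.univ : Set C) ι :=
  ⟨{y | ∃ x : ι → C, Sum.elim y x ∈ {w : ι ⊕ ι → C | w ∘ Sum.inr ∈ D} ∩ R},
    Definable.exists_sumElim ((Set.Definable.preimage_comp Sum.inr D.2).inter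
      (hR.mono (Set.empty_subset _)))⟩

theorem mem_neighbours {hR : (∅ : Set C).Definable L R}
    {D : L.DefinableSet (Set.univ : Set C) ι} {y : ι → C} :
    y ∈ neighbours hR D ↔ ∃ x ∈ D, Sum.elim y x ∈ R :=
  Iff.rfl

theorem neighbours_smul (hR : (∅ : Set C).Definable L R) (σ : C ≃[L] C)
    (D : L.DefinableSet (Set.univ : Set C) ι) :
    neighbours hR (σ • D) = σ • neighbours hR D := by
  refine SetLike.ext fun y => ?_
  rw [mem_smul_iff, mem_neighbours, mem_neighbours]
  constructor
  · rintro ⟨x, hx, hxy⟩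
    refine ⟨σ.symm ∘ x, (mem_smul_iff σ D x).1 hx, ?_⟩
    rwa [← sumElim_comp_mem_iff hR σ, comp_comp_symm, comp_comp_symm]
  · rintro ⟨x, hx, hxy⟩
    refine ⟨σ ∘ x, (comp_mem_smul_iff σ D x).2 hx, ?_⟩
    rwa [← sumElim_comp_mem_iff hR σ, comp_comp_symm] at hxy

theorem neighbours_mono (hR : (∅ : Set C).Definable L R) : Monotone (neighbours hR) :=
  fun _ _ h _ ⟨x, hx, hxy⟩ => ⟨x, h hx, hxy⟩

end Neighbours

/-! ### Coheirs -/

theorem ElementarySubstructure.exists_mem_of_definable (M : L.ElementarySubstructure C)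
    {P : Type*} [Finite P] {Z : Set (P → C)} (hZ : (M : Set C).Definable L Z)
    (hne : Z.Nonempty) : ∃ z ∈ Z, ∀ p, z p ∈ M := by
  obtain ⟨φ, rfl⟩ := Set.definable_iff_exists_formula_sum.1 hZ
  obtain ⟨c, hc⟩ := hne
  have h1 : (φ.iExs P).Realize (M.subtype ∘ (id : M → M)) :=
    Language.Formula.realize_iExs.2 ⟨c, hc⟩
  rw [M.subtype.map_formula, Language.Formula.realize_iExs] at h1
  obtain ⟨z, hz⟩ := h1
  refine ⟨fun p => z p, ?_, fun p => (z p).2⟩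
  rw [← M.subtype.map_formula] at hz
  rw [Set.mem_ofPred_eq]
  refine (iff_of_eq ?_).1 hz
  congr 1
  funext i
  obtain a | b := i <;> rfl

/-- The type of a finite tuple over a model is finitely satisfiable in the model. -/
theorem exists_coheir (M : L.ElementarySubstructure C) {P : Type*} [Finite P] (c : P → C) :
    ∃ U : Ultrafilter (P → C), (∀ᶠ z : P → C in U, ∀ p, z p ∈ M) ∧
      ∀ Z, (M : Set C).Definable L Z → c ∈ Z → Z ∈ U := by
  let I := {Z : Set (P → C) // (M : Set C).Definable L Z ∧ c ∈ Z}
  have : Nonempty I := ⟨⟨Set.univ, Set.definable_univ, trivial⟩⟩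
  let S : I → Set (P → C) := fun Z => Z.1 ∩ {z | ∀ p, z p ∈ M}
  have hNe : (⨅ Z : I, Filter.principal (S Z)).NeBot := by
    refine Filter.iInf_neBot_of_directed' ?_ fun Z => Filter.principal_neBot_iff.2 ?_
    · rintro ⟨Z, hZ, hcZ⟩ ⟨Y, hY, hcY⟩
      exact ⟨⟨Z ∩ Y, hZ.inter hY, hcZ, hcY⟩,
        Filter.principal_mono.2 fun z hz => ⟨hz.1.1, hz.2⟩,
        Filter.principal_mono.2 fun z hz => ⟨hz.1.2, hz.2⟩⟩
    · obtain ⟨z, hz, hzM⟩ :=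
        ElementarySubstructure.exists_mem_of_definable M Z.2.1 ⟨c, Z.2.2⟩
      exact ⟨z, hz, hzM⟩
  have hS : ∀ Z : I, S Z ∈ Ultrafilter.of (⨅ Z : I, Filter.principal (S Z)) := fun Z =>
    Ultrafilter.of_le _ (Filter.mem_iInf_of_mem Z (Filter.mem_principal_self _))
  refine ⟨Ultrafilter.of (⨅ Z : I, Filter.principal (S Z)), ?_, fun Z hZ hc => ?_⟩
  · exact Filter.mem_of_superset (hS ⟨Set.univ, Set.definable_univ, trivial⟩) fun z hz => hz.2
  · exact Filter.mem_of_superset (hS ⟨Z, hZ, hc⟩) fun z hz => hz.1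

namespace IsMonsterModel

variable [Nonempty C] {κ : Cardinal.{w}}

theorem card_union_lt (hC : IsMonsterModel L κ C) {A B : Set C} (hA : #A < κ) (hB : #B < κ) :
    #↥(A ∪ B) < κ :=
  (mk_union_le _ _).trans_lt (add_lt_of_lt hC.aleph0_lt.le hA hB)

theorem card_lt_of_finite (hC : IsMonsterModel L κ C) {A : Set C} (hA : A.Finite) : #A < κ :=
  hA.lt_aleph0.trans hC.aleph0_lt

/-- A Morley sequence of a coheir of the type of `c` over `M`, all of whose terms moreover form
with `c`, with `b` and with the previous terms pairs of the same type. -/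
theorem exists_coheir_seq (hC : IsMonsterModel L κ C) (M : L.ElementarySubstructure C)
    (hM : #M < κ) {P : Type w} [Finite P] (c b : P → C)
    (hb : ∀ Z, (M : Set C).Definable L Z → (c ∈ Z ↔ b ∈ Z)) :
    ∃ f : ℕ → P → C, (∀ n Z, (M : Set C).Definable L Z → c ∈ Z → f n ∈ Z) ∧
      ∀ i j, i < j → ∀ Z : Set (P ⊕ P → C), (∅ : Set C).Definable L Z →
        Sum.elim (f i) (f j) ∈ Z → Sum.elim c (f j) ∈ Z ∧ Sum.elim b (f j) ∈ Z := by
  classical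
  obtain ⟨U, hUM, hUc⟩ := exists_coheir M c
  let r : (P → C) → (P → C) → Prop := fun x y => ∀ Z : Set (P ⊕ P → C),
    (∅ : Set C).Definable L Z → (∀ᶠ z in U, Sum.elim x z ∈ Z) → Sum.elim x y ∈ Z
  let N : (P → C) → Prop := fun y =>
    (∀ Z, (M : Set C).Definable L Z → c ∈ Z → y ∈ Z) ∧ r c y ∧ r b y
  have hext : ∀ s : Finset (P → C), (∀ x ∈ s, N x) → ∃ y, N y ∧ ∀ x ∈ s, r x y := by
    intro s _
    let B : Set C := (M : Set C) ∪ ⋃ x ∈ insert c (insert b s), Set.range x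
    have hB : #B < κ := hC.card_union_lt hM
      (hC.card_lt_of_finite ((Finset.finite_toSet _).biUnion fun x _ => Set.finite_range x))
    obtain ⟨y, hy⟩ :=
      hC.exists_realization ((lt_aleph0_of_finite P).trans hC.aleph0_lt) hB U
    have hr : ∀ x ∈ insert c (insert b s), r x y := by
      intro x hx Z hZ hZU
      refine hy {z | Sum.elim x z ∈ Z} ((Definable.sumElim_section hZ x).mono ?_) hZU
      rw [Set.empty_union]
      exact (Set.subset_biUnion_of_mem (u := fun x : P → C => Set.range x) hx).trans
        Set.subset_union_right
    refine ⟨y, ⟨fun Z hZ hcZ => hy Z (hZ.mono Set.subset_union_left) (hUc Z hZ hcZ),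
      hr c (by simp), hr b (by simp)⟩, fun x hx => hr x (by simp [hx])⟩
  obtain ⟨f, hf, hfr⟩ := exists_seq_of_forall_finset_exists N r hext
  refine ⟨f, fun n => (hf n).1, fun i j hij Z hZ hfZ => ?_⟩
  -- Whether (x, z) ∈ Z for U-most z depends only on tp(x/M), because U concentrates on tuples from
  -- M. Here f i, c and b all have the same type over M.
  have key : ∀ x : P → C, (∀ Z, (M : Set C).Definable L Z → c ∈ Z → x ∈ Z) → r x (f j) →
      Sum.elim x (f j) ∈ Z := by
    intro x hx hxr
    by_contra hxZ
    have h1 : ∀ᶠ z in U, Sum.elim x z ∉ Z := by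
      by_contra h2
      exact hxZ (hxr Z hZ ((Ultrafilter.eventually_not.not_left).1 h2))
    refine hfr i j hij Zᶜ hZ.compl ?_ hfZ
    filter_upwards [h1, hUM] with z hz hzM hfz
    have hdef : (M : Set C).Definable L {x : P → C | Sum.elim x z ∈ Z} := by
      have := Definable.sumElim_section (hZ.preimage_comp Sum.swap) z
      rw [Set.empty_union] at this
      refine Set.Definable.mono ?_ (Set.range_subset_iff.2 hzM)
      convert this using 1
      ext x
      simp
    have h3 : c ∈ {x : P → C | Sum.elim x z ∈ Z} := by
      by_contra h4
      exact (hf i).1 _ hdef.compl h4 hfz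
    exact hz (hx _ hdef h3)
  exact ⟨key c (fun _ _ h => h) (hf j).2.1, key b (fun Z hZ => (hb Z hZ).1) (hf j).2.2⟩

/-! ### Invariant measures: recurrence and short paths -/

variable {ι : Type w} {μ : KeislerMeasure L C ι} {m : ι → C}

/-- A set of positive measure meets every formula of tp(m), since these have measure 1. It needs
only finitely many parameters, so saturation gives a realization of tp(m) in it, and homogeneity
makes that a conjugate of m. -/
theorem exists_comp_mem_of_pos (hC : IsMonsterModel L κ C) (hι : #ι < κ)
    (hext : ∀ ψ : L.Formula ι, ψ.Realize m → μ.toFun (definedBy ψ) = 1)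
    {D : L.DefinableSet (Set.univ : Set C) ι} (hD : 0 < μ.toFun D) :
    ∃ σ : C ≃[L] C, σ ∘ m ∈ D := by
  obtain ⟨A, -, hA⟩ := Set.definable_iff_finitely_definable.1 D.2
  let P : Set (Set (ι → C)) :=
    {Y | ∃ Z : Set (ι → C), (∅ : Set C).Definable L Z ∧ m ∈ Z ∧ Y = (D : Set (ι → C)) ∩ Z}
  obtain ⟨y, hy⟩ := hC.exists_mem_of_directed hι (hC.card_lt_of_finite A.finite_toSet) (P := P)
    ⟨_, Set.univ, Set.definable_univ, trivial, rfl⟩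
    (by
      rintro _ ⟨Z, hZ, -, rfl⟩
      exact hA.inter (hZ.mono (Set.empty_subset _)))
    (by
      rintro _ ⟨Z, hZ, hmZ, rfl⟩
      obtain ⟨ψ, rfl⟩ := Set.empty_definable_iff.1 hZ
      by_contra hne
      have h1 := μ.isFinAddProb.sup_add_inf D (definedBy ψ)
      have h2 : D ⊓ definedBy ψ = ⊥ :=
        SetLike.coe_injective (Set.not_nonempty_iff_eq_empty.1 hne)
      rw [h2, μ.isFinAddProb.bot, hext ψ hmZ] at h1
      linarith [μ.isFinAddProb.le_one (D ⊔ definedBy ψ)])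
    (by
      rintro _ ⟨Z, hZ, hmZ, rfl⟩ _ ⟨Y, hY, hmY, rfl⟩
      exact ⟨_, ⟨Z ∩ Y, hZ.inter hY, ⟨hmZ, hmY⟩, rfl⟩,
        fun x hx => ⟨⟨hx.1, hx.2.1⟩, hx.1, hx.2.2⟩⟩)
  obtain ⟨σ, hσ⟩ := hC.exists_equiv hι (a := m) (b := y)
    fun Z hZ hmZ => (hy _ ⟨Z, hZ, hmZ, rfl⟩).2
  exact ⟨σ, hσ ▸ (hy _ ⟨_, Set.definable_univ, trivial, rfl⟩).1⟩

/-- Let c enumerate the parameters of D and let g n carry c to the n-th term of the coheir sequence.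
The pairs (f i, f j), (c, f j) and (hc, f j) have the same type, so by invariance a large overlap of
g i • D and g j • D passes to g j • D with D and with h • D. -/
theorem exists_recurrent (hC : IsMonsterModel L κ C) (hinv : μ.IsInvariant)
    (M : L.ElementarySubstructure C) (hM : #M < κ) {h : C ≃[L] C} (hh : ∀ a ∈ M, h a = a)
    (D : L.DefinableSet (Set.univ : Set C) ι) (s : ℝ)
    (hs : ∀ g : ℕ → C ≃[L] C, ∃ i j, i < j ∧ s ≤ μ.toFun (g i • D ⊓ g j • D)) :
    ∃ g : C ≃[L] C, s ≤ μ.toFun (g • D ⊓ D) ∧ s ≤ μ.toFun (g • D ⊓ h • D) := by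
  obtain ⟨A, -, hA⟩ := Set.definable_iff_finitely_definable.1 D.2
  let c : A → C := fun a => a
  obtain ⟨f, hf, hfr⟩ := hC.exists_coheir_seq M hM c (h ∘ c)
    fun Z hZ => (Definable.comp_mem_iff hZ hh c).symm
  have hfin : ∀ P : Type w, Finite P → #P < κ := fun P _ =>
    (lt_aleph0_of_finite P).trans hC.aleph0_lt
  choose g hg using fun n => hC.exists_equiv (hfin A inferInstance) (a := c) (b := f n)
    fun Z hZ => hf n Z (hZ.mono (Set.empty_subset _))
  obtain ⟨i, j, hij, hsij⟩ := hs g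
  have hsmul : ∀ σ τ : C ≃[L] C, σ ∘ c = τ ∘ c → σ • D = τ • D := fun σ τ h =>
    smul_eq_smul_of_comp_eq hA fun a ha => congr_fun h ⟨a, ha⟩
  have key : ∀ k : C ≃[L] C, (∀ Z : Set (A ⊕ A → C), (∅ : Set C).Definable L Z →
      Sum.elim (f i) (f j) ∈ Z → Sum.elim (k ∘ c) (f j) ∈ Z) →
      s ≤ μ.toFun (g j • D ⊓ k • D) := by
    intro k hk
    obtain ⟨σ, hσ⟩ := hC.exists_equiv (hfin (A ⊕ A) inferInstance) hk
    rw [Sum.comp_elim] at hσ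
    have h1 : (σ * g i) • D = k • D := hsmul _ _ (by
      have := congr_arg (· ∘ Sum.inl) hσ
      simp only [Sum.elim_comp_inl] at this
      rw [← this, ← hg i]
      rfl)
    have h2 : (σ * g j) • D = g j • D := hsmul _ _ (by
      have := congr_arg (· ∘ Sum.inr) hσ
      simp only [Sum.elim_comp_inr] at this
      rw [hg j, ← this, ← hg j]
      rfl)
    rwa [inf_comm, ← h1, ← h2, mul_smul, mul_smul, ← smul_definableSet_inf, hinv.smul_eq]
  refine ⟨g j, ?_, key h fun Z hZ hfZ => (hfr i j hij Z hZ hfZ).2⟩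
  have := key 1 fun Z hZ hfZ => (hfr i j hij Z hZ hfZ).1
  rwa [one_smul] at this

/-- If `R` is a symmetric definable relation such that the orbit of `m` is covered by finitely
many fibers of `R`, then `m` and any of its images under `Autf_L(C)` are joined by an `R`-path of
length four. -/
theorem exists_path_of_mem_autfL (hC : IsMonsterModel L κ C) (hι : #ι < κ)
    (hinv : μ.IsInvariant)
    (hext : ∀ ψ : L.Formula ι, ψ.Realize m → μ.toFun (definedBy ψ) = 1)
    {R : Set (ι ⊕ ι → C)} (hR : (∅ : Set C).Definable L R)
    (hsymm : ∀ x y : ι → C, Sum.elim x y ∈ R → Sum.elim y x ∈ R)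
    (hcover : ∃ F : Finset (C ≃[L] C), ∀ g : C ≃[L] C, ∃ g' ∈ F, Sum.elim (g' ∘ m) (g ∘ m) ∈ R)
    {σ : C ≃[L] C} (hσ : σ ∈ AutfL L κ C) :
    ∃ x y z : ι → C, Sum.elim m x ∈ R ∧ Sum.elim x y ∈ R ∧ Sum.elim y z ∈ R ∧
      Sum.elim z (σ ∘ m) ∈ R := by
  have hμ := μ.isFinAddProb
  have hpos : 0 < μ.toFun (relFiber hR m) := by
    obtain ⟨F, hF⟩ := hcover
    by_contra hle
    -- If R(m) were null, so would be a finite union of its translates that contains the orbit of m;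
    -- its complement would then contain a conjugate of m.
    have h0 : μ.toFun (F.sup fun g : C ≃[L] C => relFiber hR (g ∘ m)) ≤ 0 := by
      refine (hμ.finset_sup_le _ _).trans (Finset.sum_nonpos fun g _ => ?_)
      rw [← smul_relFiber, hinv.smul_eq]
      exact not_lt.1 hle
    obtain ⟨g, hg⟩ := hC.exists_comp_mem_of_pos hι hext
      (D := (F.sup fun g : C ≃[L] C => relFiber hR (g ∘ m))ᶜ) (by rw [hμ.compl]; linarith)
    obtain ⟨g', hg', hgg'⟩ := hF g
    exact Language.DefinableSet.mem_compl.1 hg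
      (Finset.le_sup (f := fun g : C ≃[L] C => relFiber hR (g ∘ m)) hg' hgg')
  obtain ⟨D, hD, hDpos⟩ := exists_pos_smul_inf (E := neighbours hR)
    (S := {σ | ∃ M : L.ElementarySubstructure C, #M < κ ∧ ∀ a ∈ M, σ a = a}) hμ smul_definableSet_inf
    hinv.smul_eq (neighbours_mono hR) (neighbours_smul hR) hpos hpos
    (fun D hD => by
      obtain ⟨g, hg⟩ := hC.exists_comp_mem_of_pos hι hext hD
      rw [← hinv.smul_eq g, smul_relFiber]
      -- A D of positive measure contains some gm, so its neighbours include the whole fiber R(gm),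
      -- a translate of R(m); thus t = μ(R(m)) works.
      exact hμ.mono fun y hy => ⟨g ∘ m, hg, hsymm _ _ hy⟩)
    (fun h ⟨M, hM, hh⟩ D s hs => hC.exists_recurrent hinv M hM hh D s hs) hσ
  obtain ⟨g, hg⟩ := hC.exists_comp_mem_of_pos hι hext hDpos
  obtain ⟨hg1, x, hx, hgx⟩ := Language.DefinableSet.mem_inf.1 hg
  rw [mem_smul_iff] at hg1
  obtain ⟨x', hx', hgx'⟩ := hg1
  have h1 : Sum.elim m x ∈ R := hD hx
  have h2 : Sum.elim m x' ∈ R := hD hx'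
  rw [← sumElim_comp_mem_iff hR σ] at h2
  rw [← sumElim_comp_mem_iff hR σ, comp_comp_symm] at hgx'
  exact ⟨x, g ∘ m, σ ∘ x', h1, hsymm _ _ hgx, hgx', hsymm _ _ h2⟩

end IsMonsterModel

/-! ### Definable approximations to having the same type over a conjugate of a model -/

/-- Some realization of `θ` does not separate the two given tuples by the formulas in `S`. -/
def nearSet (M : L.ElementarySubstructure C) {ι : Type w} (θ : Set (M → C))
    (S : Finset (L.DefinableSet (∅ : Set C) (M ⊕ ι))) : Set (ι ⊕ ι → C) :=
  {w | ∃ n ∈ θ, ∀ Ψ ∈ S, Sum.elim n (w ∘ Sum.inl) ∈ Ψ ↔ Sum.elim n (w ∘ Sum.inr) ∈ Ψ}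

theorem definable_forall_mem_iff {α β : Type*} (S : Finset (L.DefinableSet (∅ : Set C) α))
    (f g : α → β) :
    (∅ : Set C).Definable L {w : β → C | ∀ Ψ ∈ S, w ∘ f ∈ Ψ ↔ w ∘ g ∈ Ψ} := by
  have h := Set.definable_biInter_finset (L := L) (A := (∅ : Set C))
    (f := fun Ψ : L.DefinableSet (∅ : Set C) α =>
      {w : β → C | (w ∘ f ∈ Ψ → w ∘ g ∈ Ψ) ∧ (w ∘ g ∈ Ψ → w ∘ f ∈ Ψ)})
    (fun Ψ => ?_) S
  · convert h using 1
    ext w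
    simp only [Set.mem_ofPred_eq, Set.mem_iInter, iff_def]
  · have h1 := Set.Definable.preimage_comp f Ψ.2
    have h2 := Set.Definable.preimage_comp g Ψ.2
    convert (h1.compl.union h2).inter (h2.compl.union h1) using 1
    ext w
    exact and_congr imp_iff_not_or imp_iff_not_or

theorem definable_nearSet [Nonempty C] (M : L.ElementarySubstructure C) {ι : Type w}
    {θ : Set (M → C)} (hθ : (∅ : Set C).Definable L θ)
    (S : Finset (L.DefinableSet (∅ : Set C) (M ⊕ ι))) :
    (∅ : Set C).Definable L (nearSet M θ S) := by
  have h := Definable.exists_sumElim ((hθ.preimage_comp (Sum.inr : M → (ι ⊕ ι) ⊕ M)).inter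
    (definable_forall_mem_iff S
      (Sum.elim Sum.inr (Sum.inl ∘ Sum.inl) : M ⊕ ι → (ι ⊕ ι) ⊕ M)
      (Sum.elim Sum.inr (Sum.inl ∘ Sum.inr) : M ⊕ ι → (ι ⊕ ι) ⊕ M)))
  convert h using 1
  ext w
  refine exists_congr fun n => and_congr Iff.rfl (forall₂_congr fun Ψ _ => ?_)
  rw [Sum.comp_elim, Sum.comp_elim, ← Function.comp_assoc, ← Function.comp_assoc,
    Sum.elim_comp_inr, Sum.elim_comp_inl]

theorem nearSet_symm {M : L.ElementarySubstructure C} {ι : Type w} {θ : Set (M → C)}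
    {S : Finset (L.DefinableSet (∅ : Set C) (M ⊕ ι))} {x y : ι → C}
    (h : Sum.elim x y ∈ nearSet M θ S) : Sum.elim y x ∈ nearSet M θ S := by
  obtain ⟨n, hn, hS⟩ := h
  exact ⟨n, hn, fun Ψ hΨ => (hS Ψ hΨ).symm⟩

/-- M itself serves as the realization of θ: the tuples gm realize only finitely many truth patterns
on S over M, and tuples with equal patterns are near. -/
theorem exists_cover_nearSet (M : L.ElementarySubstructure C) {ι : Type w} {θ : Set (M → C)}
    (hθ : ((↑) : M → C) ∈ θ) (S : Finset (L.DefinableSet (∅ : Set C) (M ⊕ ι))) (m : ι → C) :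
    ∃ F : Finset (C ≃[L] C), ∀ g : C ≃[L] C, ∃ g' ∈ F,
      Sum.elim (g' ∘ m) (g ∘ m) ∈ nearSet M θ S := by
  classical
  let pat : (C ≃[L] C) → S → Prop := fun g Ψ => Sum.elim ((↑) : M → C) (g ∘ m) ∈ Ψ.1
  choose s hs using fun p : Set.range pat => p.2
  have : Fintype (Set.range pat) := Fintype.ofFinite _
  refine ⟨Finset.univ.image s, fun g => ⟨s ⟨pat g, g, rfl⟩, by simp, _, hθ, fun Ψ hΨ => ?_⟩⟩
  exact iff_of_eq (congr_fun (hs ⟨pat g, g, rfl⟩) ⟨Ψ, hΨ⟩)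

/-! ### Conjugates of elementary substructures -/

/-- The image of an elementary substructure under an automorphism. -/
noncomputable def conjSubstructure (σ : C ≃[L] C) (M : L.ElementarySubstructure C) :
    L.ElementarySubstructure C where
  toSubstructure := M.toSubstructure.map σ.toEmbedding.toHom
  isElementary' := by
    intro n φ x
    let e : M.toSubstructure ≃[L] M.toSubstructure.map σ.toEmbedding.toHom :=
      σ.toEmbedding.substructureEquivMap M.toSubstructure
    have h1 : ∀ y : M.toSubstructure, ((e y : M.toSubstructure.map σ.toEmbedding.toHom) : C) = σ y :=
      fun _ => rfl
    have h2 : φ.Realize x ↔ φ.Realize (e.symm ∘ x) :=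
      (Language.StrongHomClass.realize_formula e.symm φ).symm
    have h3 : φ.Realize (e.symm ∘ x) ↔ φ.Realize (((↑) : M.toSubstructure → C) ∘ e.symm ∘ x) :=
      (M.isElementary' φ _).symm
    rw [h2, h3, ← Language.StrongHomClass.realize_formula σ φ
      (v := ((↑) : M.toSubstructure → C) ∘ e.symm ∘ x)]
    apply iff_of_eq
    congr 1
    funext i
    change _ = σ (e.symm (x i))
    rw [← h1, e.apply_symm_apply]
    rfl

theorem mem_conjSubstructure {σ : C ≃[L] C} {M : L.ElementarySubstructure C} {a : C} :
    a ∈ conjSubstructure σ M ↔ ∃ b ∈ M, σ b = a :=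
  Iff.rfl

theorem card_conjSubstructure_le (σ : C ≃[L] C) (M : L.ElementarySubstructure C) :
    #(conjSubstructure σ M) ≤ #M :=
  mk_image_le (f := σ) (s := (M : Set C))

/-- Two tuples which form tuples of the same type with an enumeration of a model have the same
type over this model. -/
theorem tpOver_conjSubstructure_eq [Nonempty C] {ι : Type w} {σ : C ≃[L] C}
    {M : L.ElementarySubstructure C} {x y : ι → C}
    (h : ∀ Ψ : L.DefinableSet (∅ : Set C) (M ⊕ ι),
      Sum.elim (fun i : M => σ i) x ∈ Ψ ↔ Sum.elim (fun i : M => σ i) y ∈ Ψ) :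
    tpOver L (conjSubstructure σ M : Set C) x = tpOver L (conjSubstructure σ M : Set C) y := by
  rw [tpOver_eq_iff]
  intro Z hZ
  obtain ⟨φ, rfl⟩ := Set.definable_iff_exists_formula_sum.1 hZ
  choose s hsM hs using fun a : (conjSubstructure σ M : Set C) => mem_conjSubstructure.1 a.2
  let f : (conjSubstructure σ M : Set C) ⊕ ι → M ⊕ ι := Sum.map (fun a => ⟨s a, hsM a⟩) id
  have key : ∀ z : ι → C, z ∈ {v | φ.Realize (Sum.elim (↑) v)} ↔
      (φ.relabel f).Realize (Sum.elim (fun i : M => σ i) z) := by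
    intro z
    rw [Language.Formula.realize_relabel, Set.mem_ofPred_eq]
    apply iff_of_eq
    congr 1
    funext i
    obtain a | b := i
    · exact (hs a).symm
    · rfl
  rw [key, key]
  exact h ⟨_, Set.empty_definable_iff.2 ⟨φ.relabel f, rfl⟩⟩

/-! ### Paths of length four -/

/-- `a` and `b` are joined by a path of length four along `R`. -/
def FourPath {ι : Type w} (R : Set (ι ⊕ ι → C)) (a b : ι → C) : Prop :=
  ∃ x y z : ι → C, Sum.elim a x ∈ R ∧ Sum.elim x y ∈ R ∧ Sum.elim y z ∈ R ∧ Sum.elim z b ∈ R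

/-- When a enumerates M, this is definability over M, and so a closed condition for the topology of
Gal_L(T). -/
theorem definable_fourPath [Nonempty C] {ι : Type w} {R : Set (ι ⊕ ι → C)}
    (hR : (∅ : Set C).Definable L R) (a : ι → C) :
    (Set.range a).Definable L {b | FourPath R a b} := by
  let p : Fin 5 → ι → ((ι ⊕ ι) ⊕ (Fin 3 × ι)) :=
    ![fun i => Sum.inl (Sum.inl i), fun i => Sum.inr (0, i), fun i => Sum.inr (1, i),
      fun i => Sum.inr (2, i), fun i => Sum.inl (Sum.inr i)]
  have hp : ∀ i j : Fin 5,
      (∅ : Set C).Definable L {w : (ι ⊕ ι) ⊕ (Fin 3 × ι) → C | w ∘ Sum.elim (p i) (p j) ∈ R} :=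
    fun i j => hR.preimage_comp _
  have h := Definable.sumElim_section (Definable.exists_sumElim
    (((hp 0 1).inter (hp 1 2)).inter ((hp 2 3).inter (hp 3 4)))) a
  rw [Set.empty_union] at h
  convert h using 1
  ext b
  have hw : ∀ (w : (ι ⊕ ι) ⊕ (Fin 3 × ι) → C) (i j : Fin 5),
      w ∘ Sum.elim (p i) (p j) = Sum.elim (w ∘ p i) (w ∘ p j) := fun w i j => Sum.comp_elim _ _ _
  constructor
  · rintro ⟨x, y, z, h1, h2, h3, h4⟩
    refine ⟨fun t => ![x, y, z] t.1 t.2, ⟨?_, ?_⟩, ?_, ?_⟩ <;>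
      rw [Set.mem_ofPred_eq, hw] <;> assumption
  · rintro ⟨t, ⟨h1, h2⟩, h3, h4⟩
    rw [Set.mem_ofPred_eq, hw] at h1 h2 h3 h4
    exact ⟨_, _, _, h1, h2, h3, h4⟩

namespace IsMonsterModel

variable [Nonempty C] {κ : Cardinal.{w}}

/-- Compactness: if `a` and `b` are joined by paths of length four along all the definable
approximations, then they are joined by a path along which consecutive tuples have the same type
over a conjugate of `M`. -/
theorem exists_chain_of_fourPath (hC : IsMonsterModel L κ C) (M : L.ElementarySubstructure C)
    (hM : #M < κ) {ι : Type w} (hι : #ι < κ) {a b : ι → C}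
    (h : ∀ θ : Set (M → C), (∅ : Set C).Definable L θ → ((↑) : M → C) ∈ θ →
      ∀ S : Finset (L.DefinableSet (∅ : Set C) (M ⊕ ι)), FourPath (nearSet M θ S) a b) :
    ∃ c : Fin 5 → ι → C, c 0 = a ∧ c 4 = b ∧ ∀ i : Fin 4, ∃ g : C ≃[L] C,
      ∀ Ψ : L.DefinableSet (∅ : Set C) (M ⊕ ι),
        Sum.elim (fun j : M => g j) (c i.castSucc) ∈ Ψ ↔
          Sum.elim (fun j : M => g j) (c i.succ) ∈ Ψ := by
  classical
  -- One tuple codes the five vertices of the path and, for each of its four edges, an enumeration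
  -- of a conjugate of M.
  let τ : Type w := (Fin 5 × ι) ⊕ (Fin 4 × M)
  have hτ : #τ < κ := by
    have hfin : ∀ n : ℕ, (n : Cardinal.{w}) < κ := fun n => (natCast_lt_aleph0).trans hC.aleph0_lt
    simp only [τ, mk_sum, mk_prod, mk_fin, lift_natCast, lift_uzero]
    simp only [lift_id]
    exact add_lt_of_lt hC.aleph0_lt.le (mul_lt_of_lt hC.aleph0_lt.le (hfin 5) hι)
      (mul_lt_of_lt hC.aleph0_lt.le (hfin 4) hM)
  let p : Fin 5 → ι → τ := fun i j => Sum.inl (i, j)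
  let q : Fin 4 → M → τ := fun i j => Sum.inr (i, j)
  let Sat : Set (M → C) → Finset (L.DefinableSet (∅ : Set C) (M ⊕ ι)) → Set (ι ⊕ ι → C) →
      Set (τ → C) := fun θ S Y =>
    {t | t ∘ Sum.elim (p 0) (p 4) ∈ Y} ∩ ⋂ i : Fin 4, ({t | t ∘ q i ∈ θ} ∩
      {t | ∀ Ψ ∈ S, t ∘ Sum.elim (q i) (p i.castSucc) ∈ Ψ ↔ t ∘ Sum.elim (q i) (p i.succ) ∈ Ψ})
  -- The sets Y only prescribe the type of the endpoints over ∅; an automorphism later moves them to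
  -- a and b.
  let P : Set (Set (τ → C)) := {Z | ∃ θ S Y, (∅ : Set C).Definable L θ ∧ ((↑) : M → C) ∈ θ ∧
    (∅ : Set C).Definable L Y ∧ Sum.elim a b ∈ Y ∧ Z = Sat θ S Y}
  obtain ⟨t, ht⟩ := hC.exists_mem_of_directed hτ (A := ∅) (P := P)
    (by rw [mk_eq_zero]; exact aleph0_pos.trans hC.aleph0_lt)
    ⟨_, Set.univ, ∅, Set.univ, Set.definable_univ, trivial, Set.definable_univ, trivial, rfl⟩
    (by
      rintro _ ⟨θ, S, Y, hθ, -, hY, -, rfl⟩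
      exact (hY.preimage_comp _).inter (Set.definable_iInter_of_finite fun i =>
        (hθ.preimage_comp _).inter (definable_forall_mem_iff S _ _)))
    (by
      rintro _ ⟨θ, S, Y, hθ, hMθ, hY, hab, rfl⟩
      obtain ⟨x, y, z, ⟨n0, hn0, h0⟩, ⟨n1, hn1, h1⟩, ⟨n2, hn2, h2⟩, ⟨n3, hn3, h3⟩⟩ :=
        h θ hθ hMθ S
      refine ⟨Sum.elim (fun t => ![a, x, y, z, b] t.1 t.2) (fun t => ![n0, n1, n2, n3] t.1 t.2),
        ?_, Set.mem_iInter.2 fun i => ⟨?_, fun Ψ hΨ => ?_⟩⟩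
      · rw [Set.mem_ofPred_eq, Sum.comp_elim]
        exact hab
      · fin_cases i <;> assumption
      · rw [Sum.comp_elim, Sum.comp_elim]
        fin_cases i
        · exact h0 Ψ hΨ
        · exact h1 Ψ hΨ
        · exact h2 Ψ hΨ
        · exact h3 Ψ hΨ)
    (by
      rintro _ ⟨θ, S, Y, hθ, hMθ, hY, hab, rfl⟩ _ ⟨θ', S', Y', hθ', hMθ', hY', hab', rfl⟩
      refine ⟨_, ⟨θ ∩ θ', S ∪ S', Y ∩ Y', hθ.inter hθ', ⟨hMθ, hMθ'⟩, hY.inter hY',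
        ⟨hab, hab'⟩, rfl⟩, fun t ⟨h1, h2⟩ => ⟨⟨h1.1, Set.mem_iInter.2 fun i => ?_⟩,
        h1.2, Set.mem_iInter.2 fun i => ?_⟩⟩
      · exact ⟨(Set.mem_iInter.1 h2 i).1.1,
          fun Ψ hΨ => (Set.mem_iInter.1 h2 i).2 Ψ (Finset.mem_union_left _ hΨ)⟩
      · exact ⟨(Set.mem_iInter.1 h2 i).1.2,
          fun Ψ hΨ => (Set.mem_iInter.1 h2 i).2 Ψ (Finset.mem_union_right _ hΨ)⟩)
  have ht' : ∀ θ S Y, (∅ : Set C).Definable L θ → ((↑) : M → C) ∈ θ →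
      (∅ : Set C).Definable L Y → Sum.elim a b ∈ Y → t ∈ Sat θ S Y := fun θ S Y h1 h2 h3 h4 =>
    ht _ ⟨θ, S, Y, h1, h2, h3, h4, rfl⟩
  have hιι : #(ι ⊕ ι) < κ := by
    rw [mk_sum, lift_id]
    exact add_lt_of_lt hC.aleph0_lt.le hι hι
  obtain ⟨σ, hσ⟩ := hC.exists_equiv hιι (a := t ∘ Sum.elim (p 0) (p 4)) (b := Sum.elim a b)
    fun Z hZ htZ => by
      by_contra habZ
      exact (ht' Set.univ ∅ Zᶜ Set.definable_univ trivial hZ.compl habZ).1 htZ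
  rw [Sum.comp_elim, Sum.comp_elim] at hσ
  refine ⟨fun i => σ ∘ t ∘ p i, ?_, ?_, fun i => ?_⟩
  · simpa using congr_arg (· ∘ Sum.inl) hσ
  · simpa using congr_arg (· ∘ Sum.inr) hσ
  obtain ⟨g, hg⟩ := hC.exists_equiv hM (a := ((↑) : M → C)) (b := t ∘ q i) fun Z hZ hMZ =>
    (Set.mem_iInter.1 (ht' Z ∅ Set.univ hZ hMZ Set.definable_univ trivial).2 i).1
  refine ⟨σ * g, fun Ψ => ?_⟩
  have h1 : (fun j : M => (σ * g) j) = σ ∘ t ∘ q i := by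
    rw [← hg]; rfl
  rw [h1, ← Sum.comp_elim, ← Sum.comp_elim, ← Sum.comp_elim, ← Sum.comp_elim]
  refine (comp_mem_iff_of_empty Ψ.2 σ _).trans (Iff.trans ?_ (comp_mem_iff_of_empty Ψ.2 σ _).symm)
  exact (Set.mem_iInter.1 (ht' Set.univ {Ψ} Set.univ Set.definable_univ trivial
    Set.definable_univ trivial).2 i).2 Ψ (Finset.mem_singleton_self Ψ)

theorem lascarChain_of_fourPath (hC : IsMonsterModel L κ C) (M : L.ElementarySubstructure C)
    (hM : #M < κ) {ι : Type w} (hι : #ι < κ) {a b : ι → C}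
    (h : ∀ θ : Set (M → C), (∅ : Set C).Definable L θ → ((↑) : M → C) ∈ θ →
      ∀ S : Finset (L.DefinableSet (∅ : Set C) (M ⊕ ι)), FourPath (nearSet M θ S) a b) :
    LascarChain L κ 4 a b := by
  obtain ⟨c, hca, hcb, hc⟩ := hC.exists_chain_of_fourPath M hM hι h
  refine ⟨fun i => if hi : i < 5 then c ⟨i, hi⟩ else a, hca, hcb, fun i hi => ?_⟩
  obtain ⟨g, hg⟩ := hc ⟨i, hi⟩
  refine ⟨conjSubstructure g M, (card_conjSubstructure_le g M).trans_lt hM, ?_⟩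
  simp only [show i < 5 by omega, show i + 1 < 5 by omega, dif_pos]
  exact tpOver_conjSubstructure_eq hg

/-- Tuples joined by a Lascar chain are conjugate under `Autf_L(C)`. -/
theorem el_of_lascarChain (hC : IsMonsterModel L κ C) {ι : Type w} (hι : #ι < κ) {n : ℕ}
    {a b : ι → C} (h : LascarChain L κ n a b) : EL L κ a b := by
  obtain ⟨c, rfl, rfl, hc⟩ := h
  induction n with
  | zero => exact ⟨1, one_mem _, rfl⟩
  | succ n ih =>
    obtain ⟨σ, hσ, hσn⟩ := ih fun i hi => hc i (by omega)
    obtain ⟨M, hM, htp⟩ := hc n (Nat.lt_succ_self n)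
    rw [tpOver_eq_iff] at htp
    have hMι : #(M ⊕ ι) < κ := by
      rw [mk_sum, lift_id, lift_id]
      exact add_lt_of_lt hC.aleph0_lt.le hM hι
    obtain ⟨g, hg⟩ := hC.exists_equiv hMι (a := Sum.elim (fun i : M => (i : C)) (c n))
      (b := Sum.elim (fun i : M => (i : C)) (c (n + 1))) fun Z hZ hcZ => by
        refine (htp {x | Sum.elim (fun i : M => (i : C)) x ∈ Z} ?_).1 hcZ
        refine (Definable.sumElim_section hZ _).mono ?_
        rw [Set.empty_union]
        exact Set.range_subset_iff.2 fun i => i.2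
    rw [Sum.comp_elim] at hg
    refine ⟨g * σ, mul_mem (Subgroup.subset_closure ⟨M, hM, fun x hx => ?_⟩) hσ, ?_⟩
    · exact congr_fun (congr_arg (· ∘ Sum.inl) hg) ⟨x, hx⟩
    · rw [show (g * σ : C ≃[L] C) ∘ c 0 = g ∘ (σ ∘ c 0) from rfl, hσn]
      simpa using congr_arg (· ∘ Sum.inr) hg

/-! ### G-compactness of amenable theories -/

variable {T : L.Theory} [C ⊨ T]

/-- Amenability enters here, through a measure extending the type of the whole tuple m. -/
theorem fourPath_of_mem_autfL (hC : IsMonsterModel L κ C) (hamen : IsAmenable T C)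
    (M : L.ElementarySubstructure C) {ι : Type w} (hι : #ι < κ) (m : ι → C)
    {θ : Set (M → C)} (hθ : (∅ : Set C).Definable L θ) (hMθ : ((↑) : M → C) ∈ θ)
    (S : Finset (L.DefinableSet (∅ : Set C) (M ⊕ ι))) {σ : C ≃[L] C} (hσ : σ ∈ AutfL L κ C) :
    FourPath (nearSet M θ S) m (σ ∘ m) := by
  obtain ⟨μ, hinv, hext⟩ := hamen ι (T.typeOf m)
  exact hC.exists_path_of_mem_autfL hι hinv
    (fun ψ hψ => hext ψ (Language.Theory.CompleteType.formula_mem_typeOf.2 hψ))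
    (definable_nearSet M hθ S) (fun _ _ => nearSet_symm) (exists_cover_nearSet M hMθ S m) hσ

/-- For the converse, the paths yield some τ in Autf_L that agrees with σ on M, and τ⁻¹σ fixes M. -/
theorem mem_autfL_iff (hC : IsMonsterModel L κ C) (hamen : IsAmenable T C)
    (M : L.ElementarySubstructure C) (hM : #M < κ) (σ : C ≃[L] C) :
    σ ∈ AutfL L κ C ↔ ∀ θ : Set (M → C), (∅ : Set C).Definable L θ → ((↑) : M → C) ∈ θ →
      ∀ S : Finset (L.DefinableSet (∅ : Set C) (M ⊕ M)),
        FourPath (nearSet M θ S) (fun x : M => (x : C)) (fun x : M => σ x) := by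
  refine ⟨fun hσ θ hθ hMθ S => hC.fourPath_of_mem_autfL hamen M hM _ hθ hMθ S hσ, fun h => ?_⟩
  obtain ⟨τ, hτ, hτσ⟩ := hC.el_of_lascarChain hM (hC.lascarChain_of_fourPath M hM hM h)
  have h1 : τ⁻¹ * σ ∈ AutfL L κ C := Subgroup.subset_closure ⟨M, hM, fun x hx => by
    change τ.symm (σ x) = x
    rw [← congr_fun hτσ ⟨x, hx⟩]
    exact τ.symm_apply_apply x⟩
  simpa using mul_mem hτ h1

theorem isGCompact (hC : IsMonsterModel L κ C) (hamen : IsAmenable T C) :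
    IsGCompact L κ C := by
  intro M hM
  have hclosed : IsClosed[galLTopology κ M] {((1 : C ≃[L] C) : GalL L κ C)} := by
    refine isClosed_coinduced.2 ?_
    have : (QuotientGroup.mk : (C ≃[L] C) → GalL L κ C) ⁻¹' {((1 : C ≃[L] C) : GalL L κ C)} =
        ⋂ (θ : Set (M → C)) (_ : (∅ : Set C).Definable L θ) (_ : ((↑) : M → C) ∈ θ)
          (S : Finset (L.DefinableSet (∅ : Set C) (M ⊕ M))), {σ : C ≃[L] C |
            (fun x : M => σ x) ∈ {b | FourPath (nearSet M θ S) (fun x : M => (x : C)) b}} := by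
      ext σ
      simp only [Set.mem_preimage, Set.mem_singleton_iff, Set.mem_iInter, Set.mem_ofPred_eq]
      rw [← hC.mem_autfL_iff hamen M hM σ, eq_comm, QuotientGroup.eq, inv_one, one_mul]
    rw [this]
    let _ := TopologicalSpace.induced (typeMap (L := L) M) inferInstance
    refine isClosed_iInter fun θ => isClosed_iInter fun hθ => isClosed_iInter fun _ =>
      isClosed_iInter fun S => isClosed_setOf_typeMap_mem M ?_
    have := definable_fourPath (definable_nearSet M hθ S) (fun x : M => (x : C))
    rwa [show Set.range (fun x : M => (x : C)) = M from Subtype.range_coe] at this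
  ext σ
  change _ ↔ (σ : GalL L κ C) ∈ @closure _ (galLTopology κ M) {((1 : C ≃[L] C) : GalL L κ C)}
  rw [@IsClosed.closure_eq _ (galLTopology κ M) _ hclosed, Set.mem_singleton_iff, eq_comm,
    QuotientGroup.eq, inv_one, one_mul]
  rfl

theorem exists_small_elementarySubstructure (hC : IsMonsterModel L κ C) :
    ∃ M : L.ElementarySubstructure C, #M < κ := by
  rcases lt_or_ge #C κ with h | h
  · exact ⟨⊤, (mk_set_le _).trans_lt h⟩
  -- The cardinal |L| lives in another universe; being below κ, it has a copy c in the universe of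
  -- C.
  obtain ⟨c, hcκ, hc⟩ := lt_lift_iff.1 hC.card_lt
  obtain ⟨M, -, hM⟩ := Language.exists_elementarySubstructure_card_eq L (∅ : Set C) (max ℵ₀ c)
    (le_max_left _ _) (by simp) (hc ▸ lift_le.2 (le_max_right _ _))
    (lift_le.2 ((max_lt hC.aleph0_lt hcκ).le.trans h))
  exact ⟨M, (lift_inj.1 hM).trans_lt (max_lt hC.aleph0_lt hcκ)⟩

end IsMonsterModel

end GCompact

theorem mainTheorem1 {L : FirstOrder.Language.{u, v}} (T : L.Theory) (hT : T.IsComplete)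
    (κ : Cardinal.{w}) (C : Type w) [L.Structure C] [Nonempty C] [C ⊨ T]
    (hC : GCompact.IsMonsterModel L κ C) (hamen : GCompact.IsAmenable T C) :
    GCompact.IsGCompact L κ C ∧
    (∀ M : L.ElementarySubstructure C, #M < κ → ∀ ι : Type w, #ι < κ → ∀ a b : ι → C,
      GCompact.EL L κ a b ↔ GCompact.EKP κ M a b) ∧
    (∀ ι : Type w, #ι < κ → ∀ a : ι → C, GCompact.lascarDiam L κ a ≤ 4) := by
  have hG := hC.isGCompact hamen
  refine ⟨hG, fun M hM ι _ a b => exists_congr fun σ => and_congr_left' ?_, fun ι hι a => ?_⟩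
  · rw [← hG M hM]
    rfl
  · obtain ⟨M, hM⟩ := hC.exists_small_elementarySubstructure
    refine iSup₂_le fun b ⟨σ, hσ, hσab⟩ => iInf₂_le 4 ?_
    refine hC.lascarChain_of_fourPath M hM hι fun θ hθ hMθ S => ?_
    rw [← hσab]
    exact hC.fourPath_of_mem_autfL hamen M hι a hθ hMθ S hσ
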